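/- **Stochastic variational principle of Hamilton–Pontryagin.** Let $Q$ be a (finite-dimensional, smooth, Hausdorff) paracompact manifold, let $a<b$ be real numbers, and let $q_1,q_2\in Q$. Let $(\Omega,\mathcal F,P)$ be a probability space with a nondecreasing family $(\mathcal F_t)$ of sub-$\sigma$-algebras of $\mathcal F$, and let $(W_i(t),\mathcal F_t)$, $i=1,\dots,m$, be independent real Wiener processes for $t\in[a,b]$. Let $\mathcal L:TQ\to\mathbb R$ and $\gamma_1,\dots,\gamma_m:Q\to\mathbb R$ be of class $C^2$ (no growth or Lipschitz condition is imposed; in particular their first derivatives may be globally Lipschitz with respect to any chosen metrics). *Path space.* Let $\mathcal C=\mathcal C([a,b],q_1,q_2)$ be the set of continuous curves $c=(q,v,p):[a,b]\to TQ\oplus T^*Q$ with $q\in C^1([a,b],Q)$, $q(a)=q_1$, $q(b)=q_2$. *Stochastic integrals.* For a path $Y$ and $s\le t$ in $[a,b]$, the integral $\int_s^t Y\circ dW_i(\omega)$ is the limit of the symmetric sums $\sum_k \tfrac12\,(Y(t_k)+Y(t_{k+1}))\,(W_i(t_{k+1},\omega)-W_i(t_k,\omega))$ as the mesh of the partition $s=t_0\le\dots\le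 t_n=t$ tends to $0$. *Action.* For $\omega\in\Omega$ and $c=(q,v,p)\in\mathcal C$ put $$\mathfrak G(\omega,c)=\int_a^b \mathcal L(q,v)\,dt+\sum_{i=1}^m\int_a^b\gamma_i(q)\circ dW_i(\omega)+\int_a^b\Big\langle p,\frac{dq}{dt}-v\Big\rangle\,dt .$$ The curve $c$ is a *critical point* of $\mathfrak G(\omega,\cdot)$ if $\frac{d}{d\varepsilon}\big|_{\varepsilon=0}\mathfrak G(\omega,c_\varepsilon)$ exists and equals $0$ for every one-parameter family $(c_\varepsilon)$ in $\mathcal C$ with $c_0=c$ which is differentiable at $\varepsilon=0$ for the $C^1$ topology on $q$ and the $C^0$ topology on $(v,p)$ (that is, the expressions of $q_\varepsilon,\dot q_\varepsilon,v_\varepsilon,p_\varepsilon$ in local coordinates are differentiable in $\varepsilon$ at $0$, uniformly in $t$). *Equations.* The curve $c$ satisfies the *stochastic HP equations* at $\omega$ if $$dq=v\,dt,\qquad dp=\frac{\partial\mathcal L}{\partial q}(q,v)\,dt+\sum_{i=1}^m\frac{\partial\gamma_i}{\partial q}(q)\circ dW_i,\qquad p=\frac{\partial\mathcal L}{\partial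 v}(q,v)$$ on $[a,b]$, where the second equation means the corresponding integral equation for the components of $p$ over each $[s,t]\subset[a,b]$ on which $q$ stays in the domain of a coordinate chart of $Q$, in the induced coordinates (with the integrals $\int_s^t \frac{\partial\gamma_i}{\partial q}(q)\circ dW_i$ existing). Then: 1. For every random curve $\omega\mapsto c(\omega)=(q,v,p)(\omega)\in\mathcal C$ such that $\omega\mapsto q(t,\omega)$ is measurable for each $t\in[a,b]$, and for every $i$, the random variable $\omega\mapsto\int_a^b\gamma_i(q(\omega))\circ dW_i(\omega)$ occurring in $\mathfrak G(\omega,c(\omega))$ is the Stratonovich integral of the process $\gamma_i(q)$ against $W_i$, i.e. the limit in probability of the symmetric sums as the mesh tends to $0$. 2. Almost surely, for every $c\in\mathcal C$: the integrals $\int_a^b\gamma_i(q)\circ dW_i(\omega)$ in $\mathfrak G(\omega,c)$ exist, and $c$ satisfies the stochastic HP equations at $\omega$ if and only if $c$ is a critical point of $\mathfrak G(\omega,\cdot)$. (The exceptional null set does not depend on $c$, so $c=c(\omega)$ may be random.) -/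

import Mathlib

open Set Filter Topology MeasureTheory ProbabilityTheory
open scoped Manifold

noncomputable section

namespace StochHP

/-! ### Wiener processes and Stratonovich integrals -/

/-- `W` is a Wiener process on `[a, b]` relative to the filtration `𝓕`: it is adapted, its paths
are almost surely continuous, and for `s ≤ t` the increment `W t - W s` is `N(0, t - s)`-distributed
and independent of `𝓕 s`. (No initial value is prescribed at time `a`.) -/
structure IsWienerOn {Ω : Type*} {mΩ : MeasurableSpace Ω} (P : Measure Ω) (𝓕 : Filtration ℝ mΩ)
    (W : ℝ → Ω → ℝ) (a b : ℝ) : Prop where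
  adapted : ∀ t ∈ Icc a b, Measurable[𝓕 t] (W t)
  continuous_paths : ∀ᵐ ω ∂P, ContinuousOn (fun t => W t ω) (Icc a b)
  hasLaw_increment : ∀ s ∈ Icc a b, ∀ t ∈ Icc a b, s ≤ t →
    HasLaw (fun ω => W t ω - W s ω) (gaussianReal 0 (Real.toNNReal (t - s))) P
  indep_increment : ∀ s ∈ Icc a b, ∀ t ∈ Icc a b, s ≤ t →
    Indep (MeasurableSpace.comap (fun ω => W t ω - W s ω) inferInstance) (𝓕 s) P

/-- A finite partition `s = τ 0 ≤ τ 1 ≤ ⋯ ≤ τ n = t` of `[s, t]`. -/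
structure TimePartition (s t : ℝ) where
  n : ℕ
  τ : ℕ → ℝ
  mono : Monotone τ
  left : τ 0 = s
  right : τ n = t

/-- The filter "mesh tends to `0`" on the partitions of `[s, t]`. -/
def meshToZero (s t : ℝ) : Filter (TimePartition s t) :=
  ⨅ δ ∈ Ioi (0 : ℝ), 𝓟 {π | ∀ k < π.n, π.τ (k + 1) - π.τ k < δ}

/-- The symmetric Riemann sum `∑ (Y(τₖ) + Y(τₖ₊₁))/2 · (W(τₖ₊₁) - W(τₖ))`. -/
def stratonovichSum (Y W : ℝ → ℝ) {s t : ℝ} (π : TimePartition s t) : ℝ :=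
  ∑ k ∈ Finset.range π.n,
    (Y (π.τ k) + Y (π.τ (k + 1))) / 2 * (W (π.τ (k + 1)) - W (π.τ k))

/-- `J` is the Stratonovich integral `∫_s^t Y ∘ dW` of the process `Y`: the symmetric
Riemann sums converge to `J` in probability as the mesh tends to `0`. -/
def IsStratonovichIntegral {Ω : Type*} {mΩ : MeasurableSpace Ω} (P : Measure Ω)
    (Y W : ℝ → Ω → ℝ) (s t : ℝ) (J : Ω → ℝ) : Prop :=
  TendstoInMeasure P
    (fun (π : TimePartition s t) ω => stratonovichSum (fun r => Y r ω) (fun r => W r ω) π)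
    (meshToZero s t) J

/-- `J` is the pathwise Stratonovich integral `∫_s^t Y ∘ dW` of a single path `Y` against a single
path `W`: the limit of the symmetric Riemann sums as the mesh tends to `0`. -/
def HasPathIntegral (Y W : ℝ → ℝ) (s t J : ℝ) : Prop :=
  Tendsto (fun π : TimePartition s t => stratonovichSum Y W π) (meshToZero s t) (𝓝 J)

open Classical in
/-- The value of the pathwise Stratonovich integral (`0` if it does not exist). -/
def pathIntegral (Y W : ℝ → ℝ) (s t : ℝ) : ℝ :=
  if h : ∃ J, HasPathIntegral Y W s t J then h.choose else 0

/-! ### The Pontryagin bundle and the path space -/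

section Geometry

variable {E : Type*} [NormedAddCommGroup E] [NormedSpace ℝ E]
variable {Q : Type*} [TopologicalSpace Q] [ChartedSpace E Q]

/-- The cotangent spaces of `Q`. -/
abbrev Cotangent (E : Type*) [NormedAddCommGroup E] [NormedSpace ℝ E] {Q : Type*}
    [TopologicalSpace Q] [ChartedSpace E Q] (x : Q) : Type _ :=
  TangentSpace 𝓘(ℝ, E) x →L[ℝ] ℝ

/-- The Pontryagin bundle `TQ ⊕ T*Q`; its elements are `⟨q, (v, p)⟩`. -/
abbrev PontryaginBundle (E : Type*) [NormedAddCommGroup E] [NormedSpace ℝ E] (Q : Type*)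
    [TopologicalSpace Q] [ChartedSpace E Q] : Type _ :=
  Bundle.TotalSpace (E × (E →L[ℝ] ℝ)) (fun x : Q => TangentSpace 𝓘(ℝ, E) x × Cotangent E x)

/-- The bundle `TQ ⊕ TQ ⊕ T*Q`; its elements are `⟨q, (u, (v, p))⟩`. -/
abbrev VelocityBundle (E : Type*) [NormedAddCommGroup E] [NormedSpace ℝ E] (Q : Type*)
    [TopologicalSpace Q] [ChartedSpace E Q] : Type _ :=
  Bundle.TotalSpace (E × (E × (E →L[ℝ] ℝ)))
    (fun x : Q => TangentSpace 𝓘(ℝ, E) x × (TangentSpace 𝓘(ℝ, E) x × Cotangent E x))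

/-- The velocity `dq/dt` at time `t` of the base curve `q` of a curve `c = (q, v, p)` over `[a, b]`
(one-sided at the endpoints). -/
def velocity (a b : ℝ) (c : ℝ → PontryaginBundle E Q) (t : ℝ) :
    TangentSpace 𝓘(ℝ, E) (c t).proj :=
  mfderivWithin 𝓘(ℝ, ℝ) 𝓘(ℝ, E) (fun r => (c r).proj) (Icc a b) t (1 : ℝ)

variable [IsManifold 𝓘(ℝ, E) ((⊤ : ℕ∞) : WithTop ℕ∞) Q]

/-- The path space `𝓒([a, b], q₁, q₂)`: continuous curves `c = (q, v, p)` in the Pontryagin bundle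
with `q` of class `C¹`, `q a = q₁` and `q b = q₂`. Only the values on `[a, b]` matter. -/
structure IsPath (a b : ℝ) (q₁ q₂ : Q) (c : ℝ → PontryaginBundle E Q) : Prop where
  continuousOn : ContinuousOn c (Icc a b)
  contMDiffOn : ContMDiffOn 𝓘(ℝ, ℝ) 𝓘(ℝ, E) 1 (fun t => (c t).proj) (Icc a b)
  left : (c a).proj = q₁
  right : (c b).proj = q₂

/-- The curve `(q, dq/dt, v, p)` in `TQ ⊕ TQ ⊕ T*Q`. It identifies a curve in the path space,
with the `C¹` topology on `q` and the `C⁰` topology on `(v, p)`, with a continuous curve in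
`TQ ⊕ TQ ⊕ T*Q`, with the `C⁰` topology. -/
def lift (a b : ℝ) (c : ℝ → PontryaginBundle E Q) (t : ℝ) : VelocityBundle E Q :=
  ⟨(c t).proj, (velocity a b c t, (c t).2)⟩

/-- The chart of `TQ ⊕ TQ ⊕ T*Q` induced by the preferred chart of `Q` at `x`. -/
def velocityChart (x : Q) :
    PartialEquiv (VelocityBundle E Q) (E × (E × (E × (E →L[ℝ] ℝ)))) :=
  extChartAt (𝓘(ℝ, E).prod 𝓘(ℝ, E × (E × (E →L[ℝ] ℝ)))) (⟨x, 0⟩ : VelocityBundle E Q)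

/-- The chart of `TQ ⊕ T*Q` induced by the preferred chart of `Q` at `x`; the coordinates are
`(q, (v, p))`. -/
def pontryaginChart (x : Q) : PartialEquiv (PontryaginBundle E Q) (E × (E × (E →L[ℝ] ℝ))) :=
  extChartAt (𝓘(ℝ, E).prod 𝓘(ℝ, E × (E →L[ℝ] ℝ))) (⟨x, 0⟩ : PontryaginBundle E Q)

/-- The chart of `TQ` induced by the preferred chart of `Q` at `x`; the coordinates are `(q, v)`. -/
def tangentChart (x : Q) : PartialEquiv (TangentBundle 𝓘(ℝ, E) Q) (E × E) :=
  extChartAt 𝓘(ℝ, E).tangent (⟨x, 0⟩ : TangentBundle 𝓘(ℝ, E) Q)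

/-- The family `Γ ε` of curves in the path space is differentiable in `ε` at `ε = 0`, for the `C¹`
topology on `q` and the `C⁰` topology on `(v, p)`: near each time `t₀ ∈ [a, b]`, the coordinate
expressions of `(q, dq/dt, v, p)` in some chart are differentiable in `ε` at `0`, uniformly in the
time. The limit `δ` consists of the coordinates of `(δq, d(δq)/dt, δv, δp)`. -/
def DifferentiableFamily (a b : ℝ) (Γ : ℝ → ℝ → PontryaginBundle E Q) : Prop :=
  ∀ t₀ ∈ Icc a b, ∃ x : Q, ∃ U ∈ 𝓝[Icc a b] t₀,
    (∀ᶠ ε in 𝓝 (0 : ℝ), ∀ t ∈ U, lift a b (Γ ε) t ∈ (velocityChart (E := E) x).source) ∧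
    ∃ δ : ℝ → E × (E × (E × (E →L[ℝ] ℝ))),
      TendstoUniformlyOn
        (fun ε t => ε⁻¹ • (velocityChart x (lift a b (Γ ε) t)
          - velocityChart x (lift a b (Γ 0) t)))
        δ (𝓝[≠] (0 : ℝ)) U

/-! ### Action, critical points and equations -/

/-- The Hamilton–Pontryagin action of the curve `c = (q, v, p)` for the driving paths `w i`:
`∫_a^b L(q, v) dt + ∑ᵢ ∫_a^b γᵢ(q) ∘ dwᵢ + ∫_a^b ⟨p, dq/dt - v⟩ dt`. -/
def action {m : ℕ} (L : TangentBundle 𝓘(ℝ, E) Q → ℝ) (γ : Fin m → Q → ℝ) (w : Fin m → ℝ → ℝ)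
    (a b : ℝ) (c : ℝ → PontryaginBundle E Q) : ℝ :=
  (∫ t in a..b, L ⟨(c t).proj, (c t).2.1⟩)
    + ∑ i, pathIntegral (fun t => γ i (c t).proj) (w i) a b
    + ∫ t in a..b, (c t).2.2 (velocity a b c t - (c t).2.1)

/-- `c` is a critical point of the action on the path space: along every one-parameter family of
curves in the path space that passes through `c` at `ε = 0` and is differentiable there, the
derivative of the action at `ε = 0` exists and vanishes. -/
def IsCritical {m : ℕ} (L : TangentBundle 𝓘(ℝ, E) Q → ℝ) (γ : Fin m → Q → ℝ)
    (w : Fin m → ℝ → ℝ) (a b : ℝ) (q₁ q₂ : Q) (c : ℝ → PontryaginBundle E Q) : Prop :=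
  ∀ Γ : ℝ → ℝ → PontryaginBundle E Q,
    (∀ᶠ ε in 𝓝 (0 : ℝ), IsPath a b q₁ q₂ (Γ ε)) → EqOn (Γ 0) c (Icc a b) →
    DifferentiableFamily a b Γ →
    HasDerivAt (fun ε => action L γ w a b (Γ ε)) 0 0

/-- The Hamilton–Pontryagin equations `dq = v dt`, `dp = ∂L/∂q dt + ∑ᵢ ∂γᵢ/∂q ∘ dwᵢ`,
`p = ∂L/∂v` on `[a, b]`. The second one is an integral equation for the components of `p` in the
coordinates `(q, v, p)` induced by a chart of `Q`; it is required for every time interval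
`[s, t]` on which `q` stays in the domain of the chart, and for every direction `e` of the
model space. -/
structure SolvesHP {m : ℕ} (L : TangentBundle 𝓘(ℝ, E) Q → ℝ) (γ : Fin m → Q → ℝ)
    (w : Fin m → ℝ → ℝ) (a b : ℝ) (c : ℝ → PontryaginBundle E Q) : Prop where
  kinematic : ∀ t ∈ Icc a b, velocity a b c t = (c t).2.1
  momentum : ∀ (x : Q) (s t : ℝ), a ≤ s → s ≤ t → t ≤ b →
    (∀ r ∈ Icc s t, (c r).proj ∈ (chartAt E x).source) → ∀ e : E,
    ∃ S : Fin m → ℝ,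
      (∀ i, HasPathIntegral
        (fun r => fderiv ℝ (fun y => γ i ((extChartAt 𝓘(ℝ, E) x).symm y))
          (extChartAt 𝓘(ℝ, E) x (c r).proj) e) (w i) s t (S i)) ∧
      (pontryaginChart x (c t)).2.2 e - (pontryaginChart x (c s)).2.2 e =
        (∫ r in s..t, fderiv ℝ (fun y => L ((tangentChart x).symm (y, (pontryaginChart x (c r)).2.1)))
          (pontryaginChart x (c r)).1 e) + ∑ i, S i
  legendre : ∀ t ∈ Icc a b,
    (c t).2.2 = fderiv ℝ (fun u : TangentSpace 𝓘(ℝ, E) (c t).proj => L ⟨(c t).proj, u⟩) (c t).2.1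

end Geometry

end StochHP

end

/-!
The exceptional null set is the set of `ω` for which some path `W i · ω` is not continuous; for all
other `ω` the argument is pathwise. For `g` of class `C¹` and `w` merely continuous, summation
by parts turns the symmetric sums of `g` against `w` into those of `w` against `g`, so they converge
to `g w` between the end points minus `∫ w g'` (`hasPathIntegral_of_hasDerivWithinAt`). Along a `C¹`
curve `q` this applies to `γᵢ(q)` and, as `γᵢ` is of class `C²`, to `∂γᵢ/∂q(q)`. Almost sure
convergence of the sums implies their convergence in probability.

Since the end points are fixed, the action therefore differs by a constant from `∫ density`, where
`density = L(q, v) + ⟨p, dq/dt - v⟩ - ∑ᵢ wᵢ d(γᵢ(q))/dt` (`IsPath.action_eq`). In a chart this is a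
`C¹` function of `(q, dq/dt, v, p)`, so along a differentiable family one may differentiate under
the integral (`DifferentiableFamily.hasDerivAt_action`). With the reduced momentum
`π = p - ∑ᵢ wᵢ dγᵢ(q)` and the force `F = ∂L/∂q - ∑ᵢ wᵢ D²γᵢ(dq/dt, ·)` the first variation is
`F δq + π (dδq/dt) + (∂L/∂v - p) δv + δp (dq/dt - v)` (`hasDerivAt_localDensity`), and a partial
integration of the stochastic integrals shows that the momentum equation says `dπ/dt = F`
(`IsPath.momentum_iff`).

If the equations hold, the first variation of the density is the time derivative of `π δq`, a
quantity which does not depend on the chart (`boundaryTerm`) and vanishes at both ends. Conversely,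
the variations of a critical curve inside a chart give the equations by the fundamental lemma of
the calculus of variations and the lemma of du Bois-Reymond (`IsCritical.integral_eq_zero`).
-/

noncomputable section

namespace StochHP

/-! ### Symmetric Riemann sums against a continuous path -/


namespace TimePartition

variable {s t : ℝ}

theorem node_mem_Icc (π : TimePartition s t) {k : ℕ} (hk : k ≤ π.n) : π.τ k ∈ Icc s t :=
  ⟨π.left.symm.trans_le (π.mono (Nat.zero_le k)), (π.mono hk).trans_eq π.right⟩

theorem le (π : TimePartition s t) : s ≤ t :=
  (π.node_mem_Icc (Nat.zero_le _)).1.trans (π.node_mem_Icc (Nat.zero_le _)).2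

/-- Partitions of arbitrarily small mesh exist: cut off the progression `s + k h` at `t`. -/
theorem exists_mesh_lt (hst : s ≤ t) {δ : ℝ} (hδ : 0 < δ) :
    ∃ π : TimePartition s t, ∀ k < π.n, π.τ (k + 1) - π.τ k < δ := by
  refine ⟨⟨⌈(t - s) / (δ / 2)⌉₊, fun k => min (s + k * (δ / 2)) t, ?_, ?_, ?_⟩, ?_⟩
  · intro i j hij
    have : (i : ℝ) ≤ j := by exact_mod_cast hij
    refine min_le_min ?_ le_rfl
    nlinarith
  · simpa using hst
  · have h := Nat.le_ceil ((t - s) / (δ / 2))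
    rw [div_le_iff₀ (by positivity)] at h
    exact min_eq_right (by linarith)
  · intro k _
    simp only [Nat.cast_add, Nat.cast_one]
    rcases le_total (s + (k : ℝ) * (δ / 2)) t with h | h
    · rw [min_eq_left h]
      have := min_le_left (s + ((k : ℝ) + 1) * (δ / 2)) t
      linarith
    · rw [min_eq_right h]
      have := min_le_right (s + ((k : ℝ) + 1) * (δ / 2)) t
      linarith

end TimePartition

theorem hasBasis_meshToZero (s t : ℝ) :
    (meshToZero s t).HasBasis (fun δ : ℝ => 0 < δ)
      (fun δ => {π | ∀ k < π.n, π.τ (k + 1) - π.τ k < δ}) := by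
  refine hasBasis_biInf_principal ?_ ⟨1, mem_Ioi.2 one_pos⟩
  intro δ hδ δ' hδ'
  exact ⟨min δ δ', mem_Ioi.2 (lt_min hδ hδ'), fun π h k hk => (h k hk).trans_le (min_le_left _ _),
    fun π h k hk => (h k hk).trans_le (min_le_right _ _)⟩

theorem neBot_meshToZero {s t : ℝ} (hst : s ≤ t) : (meshToZero s t).NeBot :=
  (hasBasis_meshToZero s t).neBot_iff.2 fun hδ => TimePartition.exists_mesh_lt hst hδ

instance isCountablyGenerated_meshToZero (s t : ℝ) : (meshToZero s t).IsCountablyGenerated := by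
  refine isCountablyGenerated_of_seq
    ⟨fun n : ℕ => {π | ∀ k < π.n, π.τ (k + 1) - π.τ k < 1 / ((n : ℝ) + 1)}, le_antisymm ?_ ?_⟩
  · refine le_iInf fun n => le_principal_iff.2 ?_
    exact (hasBasis_meshToZero s t).mem_of_mem (by positivity)
  · refine (hasBasis_meshToZero s t).ge_iff.2 fun δ hδ => ?_
    obtain ⟨n, hn⟩ := exists_nat_one_div_lt hδ
    exact mem_iInf_of_mem n (mem_principal.2 fun π hπ k hk => (hπ k hk).trans hn)

/-- The integral does not depend on the choice of the limit, as partitions of arbitrarily small mesh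
exist. -/
theorem pathIntegral_eq {Y w : ℝ → ℝ} {s t J : ℝ} (hst : s ≤ t) (h : HasPathIntegral Y w s t J) :
    pathIntegral Y w s t = J := by
  have hex : ∃ J, HasPathIntegral Y w s t J := ⟨J, h⟩
  have := neBot_meshToZero hst
  rw [pathIntegral, dif_pos hex]
  exact tendsto_nhds_unique hex.choose_spec h

/-- Summation by parts for symmetric sums: they satisfy the product rule exactly. -/
theorem stratonovichSum_add_swap (g w : ℝ → ℝ) {s t : ℝ} (π : TimePartition s t) :
    stratonovichSum g w π + stratonovichSum w g π = g t * w t - g s * w s := by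
  have h := Finset.sum_range_sub (fun k => g (π.τ k) * w (π.τ k)) π.n
  simp only [π.left, π.right] at h
  rw [← h, stratonovichSum, stratonovichSum, ← Finset.sum_add_distrib]
  exact Finset.sum_congr rfl fun k _ => by ring

/-- Symmetric sums of a continuous `w` against a `C¹` function `g` converge to `∫ w g'`. -/
theorem hasPathIntegral_deriv {g g' w : ℝ → ℝ} {s t : ℝ}
    (hw : ContinuousOn w (Icc s t))
    (hg : ∀ r ∈ Icc s t, HasDerivWithinAt g (g' r) (Icc s t) r)
    (hg' : ContinuousOn g' (Icc s t)) :
    HasPathIntegral w g s t (∫ r in s..t, w r * g' r) := by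
  obtain ⟨M, hM⟩ := isCompact_Icc.exists_bound_of_continuousOn hg'
  have hM0 : 0 ≤ |M| := abs_nonneg M
  have huc := isCompact_Icc.uniformContinuousOn_of_continuous hw
  rw [Metric.uniformContinuousOn_iff] at huc
  rw [HasPathIntegral, (hasBasis_meshToZero s t).tendsto_iff Metric.nhds_basis_closedBall]
  intro ε hε
  obtain ⟨δ, hδ, hwδ⟩ := huc (ε / ((|M| + 1) * (|t - s| + 1))) (by positivity)
  -- On a partition of mesh below `δ` the mean of `w` over the two ends of a subinterval is within
  -- `η` of `w`, so each term of the sum differs from its share of the integral by at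
  -- most `η M` times the length of the subinterval.
  refine ⟨δ, hδ, fun π hπ => ?_⟩
  have hst := π.le
  set η := ε / ((|M| + 1) * (|t - s| + 1)) with hη
  have hη0 : 0 < η := by positivity
  have hsub : ∀ k < π.n, Icc (π.τ k) (π.τ (k + 1)) ⊆ Icc s t := fun k hk =>
    Icc_subset_Icc (π.node_mem_Icc hk.le).1 (π.node_mem_Icc hk).2
  have hle : ∀ k, π.τ k ≤ π.τ (k + 1) := fun k => π.mono (Nat.le_succ k)
  have hint : ∀ k < π.n, IntervalIntegrable (fun r => w r * g' r) volume (π.τ k) (π.τ (k + 1)) := by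
    intro k hk
    refine ContinuousOn.intervalIntegrable ?_
    rw [uIcc_of_le (hle k)]
    exact (hw.mul hg').mono (hsub k hk)
  have hint' : ∀ k < π.n, IntervalIntegrable g' volume (π.τ k) (π.τ (k + 1)) := by
    intro k hk
    refine ContinuousOn.intervalIntegrable ?_
    rw [uIcc_of_le (hle k)]
    exact hg'.mono (hsub k hk)
  have htot : ∫ r in s..t, w r * g' r
      = ∑ k ∈ Finset.range π.n, ∫ r in π.τ k..π.τ (k + 1), w r * g' r := by
    rw [intervalIntegral.sum_integral_adjacent_intervals hint, π.left, π.right]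
  have hincr : ∀ k < π.n, g (π.τ (k + 1)) - g (π.τ k) = ∫ r in π.τ k..π.τ (k + 1), g' r := by
    intro k hk
    refine (intervalIntegral.integral_eq_sub_of_hasDeriv_right_of_le (hle k) ?_ ?_
      (hint' k hk)).symm
    · exact fun r hr => ((hg r (hsub k hk hr)).continuousWithinAt).mono (hsub k hk)
    · intro r hr
      refine (hg r (hsub k hk (Ioo_subset_Icc_self hr))).mono_of_mem_nhdsWithin ?_
      exact mem_of_superset (Ioo_mem_nhdsGT hr.2)
        fun y hy => hsub k hk ⟨hr.1.le.trans hy.1.le, hy.2.le⟩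
  rw [mem_closedBall_iff_norm, htot, stratonovichSum, ← Finset.sum_sub_distrib]
  have hterm : ∀ k ∈ Finset.range π.n,
      ‖(w (π.τ k) + w (π.τ (k + 1))) / 2 * (g (π.τ (k + 1)) - g (π.τ k))
        - ∫ r in π.τ k..π.τ (k + 1), w r * g' r‖ ≤ η * |M| * (π.τ (k + 1) - π.τ k) := by
    intro k hk
    rw [Finset.mem_range] at hk
    rw [hincr k hk, ← intervalIntegral.integral_const_mul,
      ← intervalIntegral.integral_sub ((hint' k hk).const_mul _) (hint k hk)]
    have hb := intervalIntegral.norm_integral_le_of_norm_le_const (a := π.τ k) (b := π.τ (k + 1))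
      (f := fun r => (w (π.τ k) + w (π.τ (k + 1))) / 2 * g' r - w r * g' r) (C := η * |M|) ?_
    · rwa [abs_of_nonneg (sub_nonneg.2 (hle k))] at hb
    · intro r hr
      rw [uIoc_of_le (hle k)] at hr
      have hr' : r ∈ Icc (π.τ k) (π.τ (k + 1)) := ⟨hr.1.le, hr.2⟩
      have hgap := hπ k hk
      have h1 := hwδ _ (π.node_mem_Icc hk.le) r (hsub k hk hr')
        (by rw [Real.dist_eq, abs_sub_comm, abs_of_nonneg (by linarith [hr'.1])]
            linarith [hr'.2])
      have h2 := hwδ _ (π.node_mem_Icc hk) r (hsub k hk hr')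
        (by rw [Real.dist_eq, abs_of_nonneg (by linarith [hr'.2])]; linarith [hr'.1])
      rw [Real.dist_eq, abs_lt] at h1 h2
      rw [← sub_mul, norm_mul]
      refine mul_le_mul ?_ ((hM r (hsub k hk hr')).trans (le_abs_self M)) (norm_nonneg _) hη0.le
      rw [Real.norm_eq_abs, abs_le]
      constructor <;> linarith [h1.1, h1.2, h2.1, h2.2]
  refine (norm_sum_le_of_le _ hterm).trans ?_
  rw [← Finset.mul_sum, Finset.sum_range_sub, π.left, π.right]
  have h0 : t - s ≤ |t - s| + 1 := by linarith [le_abs_self (t - s)]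
  calc η * |M| * (t - s) ≤ η * (|M| + 1) * (|t - s| + 1) := by
        have h1 : 0 ≤ t - s := sub_nonneg.2 hst
        gcongr
        linarith
    _ = ε := by rw [hη]; field_simp

/-- The pathwise Stratonovich integral of a `C¹` function against a merely continuous path exists,
and equals the one obtained by integration by parts. -/
theorem hasPathIntegral_of_hasDerivWithinAt {g g' w : ℝ → ℝ} {s t : ℝ}
    (hw : ContinuousOn w (Icc s t))
    (hg : ∀ r ∈ Icc s t, HasDerivWithinAt g (g' r) (Icc s t) r)
    (hg' : ContinuousOn g' (Icc s t)) :
    HasPathIntegral g w s t (g t * w t - g s * w s - ∫ r in s..t, w r * g' r) :=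
  (tendsto_const_nhds.sub (hasPathIntegral_deriv hw hg hg')).congr fun π =>
    (eq_sub_of_add_eq (stratonovichSum_add_swap g w π)).symm

/-! ### From pathwise convergence to convergence in probability -/

/-- If almost every path of the symmetric sums converges, the sums converge in probability. -/
theorem isStratonovichIntegral_of_ae {Ω : Type*} {mΩ : MeasurableSpace Ω} {P : Measure Ω}
    [IsFiniteMeasure P] {Y W : ℝ → Ω → ℝ} {s t : ℝ} {J : Ω → ℝ}
    (hY : ∀ r ∈ Icc s t, Measurable (Y r)) (hW : ∀ r ∈ Icc s t, Measurable (W r))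
    (h : ∀ᵐ ω ∂P, HasPathIntegral (fun r => Y r ω) (fun r => W r ω) s t (J ω)) :
    IsStratonovichIntegral P Y W s t J := by
  have hmeas : ∀ π : TimePartition s t, Measurable
      (fun ω => stratonovichSum (fun r => Y r ω) (fun r => W r ω) π) := by
    intro π
    refine Finset.measurable_fun_sum _ fun k hk => ?_
    have h0 := π.node_mem_Icc (Finset.mem_range.1 hk).le
    have h1 := π.node_mem_Icc (Nat.succ_le_of_lt (Finset.mem_range.1 hk))
    exact (((hY _ h0).add (hY _ h1)).div_const 2).mul ((hW _ h1).sub (hW _ h0))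
  intro ε hε
  -- Convergence almost everywhere implies convergence in measure for sequences of functions; the
  -- mesh filter is countably generated.
  refine tendsto_of_seq_tendsto fun u hu => ?_
  refine tendstoInMeasure_of_tendsto_ae (fun n => (hmeas (u n)).aestronglyMeasurable) ?_ ε hε
  filter_upwards [h] with ω hω using hω.comp hu

/-! ### Coordinates on the bundles over a chart -/

section

variable {E : Type*} [NormedAddCommGroup E] [NormedSpace ℝ E]
variable {Q : Type*} [TopologicalSpace Q] [ChartedSpace E Q]

variable (E) in
/-- The function `g` on `Q` in the chart at `x`. -/
def localPotential (g : Q → ℝ) (x : Q) (y : E) : ℝ :=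
  g ((extChartAt 𝓘(ℝ, E) x).symm y)

theorem localPotential_apply (g : Q → ℝ) {x q : Q} (hq : q ∈ (chartAt E x).source) :
    localPotential E g x (extChartAt 𝓘(ℝ, E) x q) = g q := by
  rw [localPotential, (extChartAt 𝓘(ℝ, E) x).left_inv (by simpa using hq)]

variable [IsManifold 𝓘(ℝ, E) ((⊤ : ℕ∞) : WithTop ℕ∞) Q]

/-- The coordinate expression, in the chart at `x`, of the tangent vectors at `q`; it is zero if `q`
is outside the domain of the chart. -/
def tangentCoord (x q : Q) : TangentSpace 𝓘(ℝ, E) q →L[ℝ] E :=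
  (trivializationAt E (TangentSpace 𝓘(ℝ, E)) x).continuousLinearMapAt ℝ q

/-- The inverse of `tangentCoord x q`, for `q` in the domain of the chart at `x`. -/
def tangentCoordSymm (x q : Q) : E →L[ℝ] TangentSpace 𝓘(ℝ, E) q :=
  (trivializationAt E (TangentSpace 𝓘(ℝ, E)) x).symmL ℝ q

theorem mem_baseSet {x q : Q} (hq : q ∈ (chartAt E x).source) :
    q ∈ (trivializationAt E (TangentSpace 𝓘(ℝ, E)) x).baseSet := by simpa using hq

theorem trivializationAt_tangent_apply {x q : Q} (hq : q ∈ (chartAt E x).source)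
    (v : TangentSpace 𝓘(ℝ, E) q) :
    (trivializationAt E (TangentSpace 𝓘(ℝ, E)) x ⟨q, v⟩).2 = tangentCoord x q v := by
  simp [tangentCoord, Bundle.Trivialization.coe_linearMapAt_of_mem _ (mem_baseSet hq)]

/-- The coordinates of a covector: the hom bundle is trivialized by precomposition with the inverse
trivialization of the tangent bundle, its target being a trivial bundle. -/
theorem trivializationAt_cotangent_apply (x q : Q) (p : Cotangent E q) :
    (trivializationAt (E →L[ℝ] ℝ) (Cotangent E (Q := Q)) x ⟨q, p⟩).2
      = p.comp (tangentCoordSymm x q) := by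
  have h := hom_trivializationAt_apply (σ := RingHom.id ℝ) (F₁ := E) (F₂ := ℝ)
    (E₁ := TangentSpace 𝓘(ℝ, E) (M := Q)) (E₂ := Bundle.Trivial Q ℝ) x ⟨q, p⟩
  refine (congrArg Prod.snd h).trans ?_
  ext e
  simp only [ContinuousLinearMap.inCoordinates]
  simp [tangentCoordSymm]

theorem tangentChart_apply {x q : Q} (hq : q ∈ (chartAt E x).source)
    (v : TangentSpace 𝓘(ℝ, E) q) :
    tangentChart x ⟨q, v⟩ = (extChartAt 𝓘(ℝ, E) x q, tangentCoord x q v) := by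
  rw [tangentChart, ModelWithCorners.tangent, FiberBundle.extChartAt]
  simp [← trivializationAt_tangent_apply hq]

theorem pontryaginChart_apply {x q : Q} (hq : q ∈ (chartAt E x).source)
    (v : TangentSpace 𝓘(ℝ, E) q) (p : Cotangent E q) :
    pontryaginChart x ⟨q, (v, p)⟩
      = (extChartAt 𝓘(ℝ, E) x q, (tangentCoord x q v, p.comp (tangentCoordSymm x q))) := by
  rw [← trivializationAt_tangent_apply hq, ← trivializationAt_cotangent_apply,
    pontryaginChart, FiberBundle.extChartAt]
  rfl

theorem velocityChart_apply {x q : Q} (hq : q ∈ (chartAt E x).source)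
    (u v : TangentSpace 𝓘(ℝ, E) q) (p : Cotangent E q) :
    velocityChart x ⟨q, (u, (v, p))⟩ = (extChartAt 𝓘(ℝ, E) x q,
      (tangentCoord x q u, (tangentCoord x q v, p.comp (tangentCoordSymm x q)))) := by
  rw [← trivializationAt_tangent_apply hq, ← trivializationAt_tangent_apply hq,
    ← trivializationAt_cotangent_apply, velocityChart, FiberBundle.extChartAt]
  rfl

theorem tangentCoord_symm {x q : Q} (hq : q ∈ (chartAt E x).source) (e : E) :
    tangentCoord x q (tangentCoordSymm x q e) = e :=
  (trivializationAt E (TangentSpace 𝓘(ℝ, E)) x).continuousLinearMapAt_symmL (mem_baseSet hq) e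

theorem tangentCoordSymm_apply {x q : Q} (hq : q ∈ (chartAt E x).source)
    (v : TangentSpace 𝓘(ℝ, E) q) :
    tangentCoordSymm x q (tangentCoord x q v) = v :=
  (trivializationAt E (TangentSpace 𝓘(ℝ, E)) x).symmL_continuousLinearMapAt (mem_baseSet hq) v

theorem mem_tangentChart_source {x : Q} {z : TangentBundle 𝓘(ℝ, E) Q} :
    z ∈ (tangentChart x).source ↔ z.proj ∈ (chartAt E x).source := by
  rw [tangentChart, ModelWithCorners.tangent, FiberBundle.extChartAt]
  simp

theorem mem_pontryaginChart_source {x : Q} {z : PontryaginBundle E Q} :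
    z ∈ (pontryaginChart x).source ↔ z.proj ∈ (chartAt E x).source := by
  rw [pontryaginChart, FiberBundle.extChartAt]
  simp
  exact id

theorem mem_velocityChart_source {x : Q} {z : VelocityBundle E Q} :
    z ∈ (velocityChart (E := E) x).source ↔ z.proj ∈ (chartAt E x).source := by
  rw [velocityChart, FiberBundle.extChartAt]
  simp
  exact id

theorem tangentChart_target (x : Q) :
    (tangentChart x).target = (extChartAt 𝓘(ℝ, E) x).target ×ˢ (univ : Set E) := by
  rw [tangentChart, ModelWithCorners.tangent, FiberBundle.extChartAt_target]
  congr 1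
  refine inter_eq_left.2 fun y hy => mem_baseSet ?_
  simpa using (extChartAt 𝓘(ℝ, E) x).map_target hy

theorem pontryaginChart_target (x : Q) :
    (pontryaginChart x).target
      = (extChartAt 𝓘(ℝ, E) x).target ×ˢ (univ : Set (E × (E →L[ℝ] ℝ))) := by
  rw [pontryaginChart, FiberBundle.extChartAt_target]
  congr 1
  refine inter_eq_left.2 fun y hy => ?_
  have h := mem_baseSet (by simpa using (extChartAt 𝓘(ℝ, E) x).map_target hy)
  exact ⟨h, h, mem_univ _⟩

/-- The coordinates of the velocity of a curve are the derivative of its coordinates. -/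
theorem hasDerivWithinAt_extChartAt_comp {f : ℝ → Q} {s : Set ℝ} {t : ℝ} {x : Q}
    (hf : MDifferentiableWithinAt 𝓘(ℝ, ℝ) 𝓘(ℝ, E) f s t) (hx : f t ∈ (chartAt E x).source) :
    HasDerivWithinAt (fun r => extChartAt 𝓘(ℝ, E) x (f r))
      (tangentCoord x (f t) (mfderivWithin 𝓘(ℝ, ℝ) 𝓘(ℝ, E) f s t (1 : ℝ))) s t := by
  have h := (hasMFDerivAt_extChartAt (I := 𝓘(ℝ, E)) hx).comp_hasMFDerivWithinAt t
    hf.hasMFDerivWithinAt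
  rw [hasMFDerivWithinAt_iff_hasFDerivWithinAt] at h
  rw [tangentCoord, TangentBundle.continuousLinearMapAt_trivializationAt hx]
  have h' : HasFDerivWithinAt (fun r => extChartAt 𝓘(ℝ, E) x (f r))
    (show ℝ →L[ℝ] E from (mfderiv 𝓘(ℝ, E) 𝓘(ℝ, E) (extChartAt 𝓘(ℝ, E) x) (f t)).comp
      (mfderivWithin 𝓘(ℝ, ℝ) 𝓘(ℝ, E) f s t)) s t := h
  exact h'.hasDerivWithinAt

/-- The Lagrangian in the coordinates `(q, v)` induced by the chart at `x`. -/
def localLagrangian (L : TangentBundle 𝓘(ℝ, E) Q → ℝ) (x : Q) (z : E × E) : ℝ :=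
  L ((tangentChart x).symm z)

theorem contDiffOn_localLagrangian {L : TangentBundle 𝓘(ℝ, E) Q → ℝ}
    (hL : ContMDiff 𝓘(ℝ, E).tangent 𝓘(ℝ, ℝ) 2 L) (x : Q) :
    ContDiffOn ℝ 2 (localLagrangian L x) ((extChartAt 𝓘(ℝ, E) x).target ×ˢ univ) := by
  have : IsManifold 𝓘(ℝ, E).tangent 2 (TangentBundle 𝓘(ℝ, E) Q) := inferInstance
  rw [← tangentChart_target, ← contMDiffOn_iff_contDiffOn]
  exact hL.comp_contMDiffOn (contMDiffOn_extChartAt_symm _)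

theorem contDiffOn_localPotential {g : Q → ℝ} (hg : ContMDiff 𝓘(ℝ, E) 𝓘(ℝ, ℝ) 2 g) (x : Q) :
    ContDiffOn ℝ 2 (localPotential E g x) (extChartAt 𝓘(ℝ, E) x).target := by
  rw [← contMDiffOn_iff_contDiffOn]
  have : IsManifold 𝓘(ℝ, E) 2 Q := inferInstance
  exact hg.comp_contMDiffOn (contMDiffOn_extChartAt_symm _)

theorem localLagrangian_apply (L : TangentBundle 𝓘(ℝ, E) Q → ℝ) {x q : Q}
    (hq : q ∈ (chartAt E x).source) (v : TangentSpace 𝓘(ℝ, E) q) :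
    localLagrangian L x (extChartAt 𝓘(ℝ, E) x q, tangentCoord x q v) = L ⟨q, v⟩ := by
  rw [← tangentChart_apply hq, localLagrangian,
    (tangentChart x).left_inv (mem_tangentChart_source.2 hq)]

variable {a b : ℝ} {q₁ q₂ : Q} {c : ℝ → PontryaginBundle E Q}

theorem velocityChart_lift {x : Q} {t : ℝ} (hx : (c t).proj ∈ (chartAt E x).source) :
    velocityChart x (lift a b c t) = ((pontryaginChart x (c t)).1,
      (tangentCoord x (c t).proj (velocity a b c t), (pontryaginChart x (c t)).2)) := by
  have h := velocityChart_apply hx (velocity a b c t) (c t).2.1 (c t).2.2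
  have h' := pontryaginChart_apply hx (c t).2.1 (c t).2.2
  rw [show c t = ⟨(c t).proj, ((c t).2.1, (c t).2.2)⟩ from rfl, h']
  exact h

namespace IsPath

theorem continuousOn_proj (hc : IsPath a b q₁ q₂ c) :
    ContinuousOn (fun t => (c t).proj) (Icc a b) := hc.contMDiffOn.continuousOn

theorem hasDerivWithinAt_coord (hc : IsPath a b q₁ q₂ c) {x : Q} {t : ℝ} (ht : t ∈ Icc a b)
    (hx : (c t).proj ∈ (chartAt E x).source) :
    HasDerivWithinAt (fun r => extChartAt 𝓘(ℝ, E) x (c r).proj)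
      (tangentCoord x (c t).proj (velocity a b c t)) (Icc a b) t :=
  hasDerivWithinAt_extChartAt_comp
    ((hc.contMDiffOn t ht).mdifferentiableWithinAt one_ne_zero) hx

theorem eventually_mem_source (hc : IsPath a b q₁ q₂ c) {x : Q} {t : ℝ} (ht : t ∈ Icc a b)
    (hx : (c t).proj ∈ (chartAt E x).source) :
    ∀ᶠ r in 𝓝[Icc a b] t, (c r).proj ∈ (chartAt E x).source :=
  (hc.continuousOn_proj t ht).eventually ((chartAt E x).open_source.mem_nhds hx)

theorem contDiffWithinAt_coord (hc : IsPath a b q₁ q₂ c) {x : Q} {t : ℝ} (ht : t ∈ Icc a b)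
    (hx : (c t).proj ∈ (chartAt E x).source) :
    ContDiffWithinAt ℝ 1 (fun r => extChartAt 𝓘(ℝ, E) x (c r).proj) (Icc a b) t := by
  rw [← contMDiffWithinAt_iff_contDiffWithinAt]
  exact (contMDiffAt_extChartAt' hx).comp_contMDiffWithinAt t (hc.contMDiffOn t ht)

/-- Curves in the path space have continuous coordinates `(q, dq/dt, v, p)`. -/
theorem continuousWithinAt_velocityChart_lift (hab : a < b) (hc : IsPath a b q₁ q₂ c) {x : Q}
    {t : ℝ} (ht : t ∈ Icc a b) (hx : (c t).proj ∈ (chartAt E x).source) :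
    ContinuousWithinAt (fun r => velocityChart x (lift a b c r)) (Icc a b) t := by
  have hev := hc.eventually_mem_source ht hx
  have h1 : ContinuousWithinAt (fun r => pontryaginChart x (c r)) (Icc a b) t :=
    (continuousAt_extChartAt' (I := 𝓘(ℝ, E).prod 𝓘(ℝ, E × (E →L[ℝ] ℝ)))
      (mem_pontryaginChart_source.2 hx)).comp_continuousWithinAt (hc.continuousOn t ht)
  have h2 : ContinuousWithinAt
      (fun r => derivWithin (fun r => extChartAt 𝓘(ℝ, E) x (c r).proj) (Icc a b) r)
      (Icc a b) t :=
    (((hc.contDiffWithinAt_coord ht hx).fderivWithin_right (uniqueDiffOn_Icc hab)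
      (m := 0) (by simp) ht).continuousWithinAt).clm_apply continuousWithinAt_const
  refine (h1.fst.prodMk (h2.prodMk h1.snd)).congr_of_eventuallyEq_of_mem ?_ ht
  filter_upwards [hev, self_mem_nhdsWithin] with r hr hrI
  rw [velocityChart_lift hr,
    (hc.hasDerivWithinAt_coord hrI hr).derivWithin (uniqueDiffOn_Icc hab r hrI)]

end IsPath

end

/-! ### The action as an ordinary integral -/

section

variable {E : Type*} [NormedAddCommGroup E] [NormedSpace ℝ E]
variable {Q : Type*} [TopologicalSpace Q] [ChartedSpace E Q]
variable {m : ℕ}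

/-- The integrand of the action after integration by parts in the stochastic terms:
`L(q, v) + ⟨p, dq/dt - v⟩ - ∑ᵢ wᵢ d(γᵢ(q))/dt`. -/
def density (L : TangentBundle 𝓘(ℝ, E) Q → ℝ) (γ : Fin m → Q → ℝ) (w : Fin m → ℝ → ℝ)
    (a b : ℝ) (c : ℝ → PontryaginBundle E Q) (t : ℝ) : ℝ :=
  L ⟨(c t).proj, (c t).2.1⟩ + (c t).2.2 (velocity a b c t - (c t).2.1)
    - ∑ i, w i t * derivWithin (fun r => γ i (c r).proj) (Icc a b) t

theorem mem_target_of_mem_source {x q : Q} (hq : q ∈ (chartAt E x).source) :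
    extChartAt 𝓘(ℝ, E) x q ∈ (extChartAt 𝓘(ℝ, E) x).target :=
  (extChartAt 𝓘(ℝ, E) x).map_source (by simpa using hq)

theorem isOpen_preimage_target (x : Q) :
    IsOpen {kz : (Fin m → ℝ) × (E × (E × (E × (E →L[ℝ] ℝ)))) |
      kz.2.1 ∈ (extChartAt 𝓘(ℝ, E) x).target} :=
  (isOpen_extChartAt_target x).preimage (by fun_prop)

variable [IsManifold 𝓘(ℝ, E) ((⊤ : ℕ∞) : WithTop ℕ∞) Q]

/-- The density in the coordinates `(q, dq/dt, v, p)`, for given values `k` of the driving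
paths. -/
def localDensity (L : TangentBundle 𝓘(ℝ, E) Q → ℝ) (γ : Fin m → Q → ℝ) (x : Q)
    (k : Fin m → ℝ) (z : E × (E × (E × (E →L[ℝ] ℝ)))) : ℝ :=
  localLagrangian L x (z.1, z.2.2.1) + z.2.2.2 (z.2.1 - z.2.2.1)
    - ∑ i, k i * fderiv ℝ (localPotential E (γ i) x) z.1 z.2.1

variable {a b : ℝ} {q₁ q₂ : Q} {c : ℝ → PontryaginBundle E Q}
variable {L : TangentBundle 𝓘(ℝ, E) Q → ℝ} {γ : Fin m → Q → ℝ} {w : Fin m → ℝ → ℝ}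

theorem differentiableAt_localPotential {g : Q → ℝ} (hg : ContMDiff 𝓘(ℝ, E) 𝓘(ℝ, ℝ) 2 g)
    {x : Q} {y : E} (hy : y ∈ (extChartAt 𝓘(ℝ, E) x).target) :
    DifferentiableAt ℝ (localPotential E g x) y :=
  ((contDiffOn_localPotential hg x).contDiffAt
    ((isOpen_extChartAt_target x).mem_nhds hy)).differentiableAt two_ne_zero

theorem contDiffOn_fderiv_localPotential {g : Q → ℝ} (hg : ContMDiff 𝓘(ℝ, E) 𝓘(ℝ, ℝ) 2 g)
    (x : Q) : ContDiffOn ℝ 1 (fderiv ℝ (localPotential E g x)) (extChartAt 𝓘(ℝ, E) x).target :=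
  (contDiffOn_localPotential hg x).fderiv_of_isOpen (isOpen_extChartAt_target x)
    (by norm_num)

theorem contDiffOn_localDensity (hL : ContMDiff 𝓘(ℝ, E).tangent 𝓘(ℝ, ℝ) 2 L)
    (hγ : ∀ i, ContMDiff 𝓘(ℝ, E) 𝓘(ℝ, ℝ) 2 (γ i)) (x : Q) :
    ContDiffOn ℝ 1
      (fun kz : (Fin m → ℝ) × (E × (E × (E × (E →L[ℝ] ℝ)))) => localDensity L γ x kz.1 kz.2)
      {kz | kz.2.1 ∈ (extChartAt 𝓘(ℝ, E) x).target} := by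
  refine ContDiffOn.sub (ContDiffOn.add ?_ ?_) (ContDiffOn.sum fun i _ => ContDiffOn.mul ?_ ?_)
  · refine ((contDiffOn_localLagrangian hL x).of_le (by norm_num)).comp
      (ContDiff.contDiffOn (by fun_prop)) fun kz hkz => ⟨hkz, mem_univ _⟩
  · exact (ContDiff.clm_apply (by fun_prop) (by fun_prop)).contDiffOn
  · fun_prop
  · refine ContDiffOn.clm_apply ?_ (by fun_prop)
    exact (contDiffOn_fderiv_localPotential (hγ i) x).comp (by fun_prop) fun kz hkz => hkz

namespace IsPath

theorem hasDerivWithinAt_potential (hc : IsPath a b q₁ q₂ c) {g : Q → ℝ}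
    (hg : ContMDiff 𝓘(ℝ, E) 𝓘(ℝ, ℝ) 2 g) {x : Q} {t : ℝ} (ht : t ∈ Icc a b)
    (hx : (c t).proj ∈ (chartAt E x).source) :
    HasDerivWithinAt (fun r => g (c r).proj)
      (fderiv ℝ (localPotential E g x) (extChartAt 𝓘(ℝ, E) x (c t).proj)
        (tangentCoord x (c t).proj (velocity a b c t))) (Icc a b) t := by
  have h := (differentiableAt_localPotential hg
    (mem_target_of_mem_source hx)).hasFDerivAt.comp_hasDerivWithinAt t
    (hc.hasDerivWithinAt_coord ht hx)
  refine h.congr_of_eventuallyEq_of_mem ?_ ht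
  filter_upwards [hc.eventually_mem_source ht hx] with r hr
  exact (localPotential_apply g hr).symm

/-- The density at the time `t` depends on the curve only through the coordinates of
`(q, dq/dt, v, p)` at that time. -/
theorem density_eq_localDensity (hab : a < b) (hc : IsPath a b q₁ q₂ c)
    (hγ : ∀ i, ContMDiff 𝓘(ℝ, E) 𝓘(ℝ, ℝ) 2 (γ i)) {x : Q} {t : ℝ} (ht : t ∈ Icc a b)
    (hx : (c t).proj ∈ (chartAt E x).source) :
    density L γ w a b c t
      = localDensity L γ x (fun i => w i t) (velocityChart x (lift a b c t)) := by
  have h := velocityChart_apply hx (velocity a b c t) (c t).2.1 (c t).2.2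
  rw [show velocityChart x (lift a b c t) = _ from h]
  simp only [density, localDensity, localLagrangian_apply L hx]
  congr 2
  · rw [ContinuousLinearMap.comp_apply, ← map_sub, tangentCoordSymm_apply hx]
  · funext i
    rw [(hc.hasDerivWithinAt_potential (hγ i) ht hx).derivWithin (uniqueDiffOn_Icc hab t ht)]

theorem continuousOn_density (hab : a < b) (hc : IsPath a b q₁ q₂ c)
    (hL : ContMDiff 𝓘(ℝ, E).tangent 𝓘(ℝ, ℝ) 2 L)
    (hγ : ∀ i, ContMDiff 𝓘(ℝ, E) 𝓘(ℝ, ℝ) 2 (γ i)) (hw : ∀ i, ContinuousOn (w i) (Icc a b)) :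
    ContinuousOn (density L γ w a b c) (Icc a b) := by
  intro t ht
  have hx := mem_chart_source E (c t).proj
  have hz := hc.continuousWithinAt_velocityChart_lift hab ht hx
  have hk : ContinuousWithinAt (fun r => fun i => w i r) (Icc a b) t :=
    continuousWithinAt_pi.2 fun i => hw i t ht
  have hmem : (fun i => w i t, velocityChart (c t).proj (lift a b c t)) ∈
      {kz : (Fin m → ℝ) × (E × (E × (E × (E →L[ℝ] ℝ)))) |
        kz.2.1 ∈ (extChartAt 𝓘(ℝ, E) (c t).proj).target} := by
    rw [velocityChart_lift hx]
    have h := pontryaginChart_apply hx (c t).2.1 (c t).2.2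
    simp [show pontryaginChart (c t).proj (c t) = _ from h]
  have hΦ := ((contDiffOn_localDensity hL hγ (c t).proj).contDiffAt
    ((isOpen_preimage_target _).mem_nhds hmem)).continuousAt
  refine (hΦ.comp_continuousWithinAt
    (f := fun r => (fun i => w i r, velocityChart (c t).proj (lift a b c r)))
    (hk.prodMk hz)).congr_of_eventuallyEq_of_mem ?_ ht
  filter_upwards [hc.eventually_mem_source ht hx, self_mem_nhdsWithin] with r hr hrI
  exact hc.density_eq_localDensity hab hγ hrI hr

theorem continuousOn_pairing (hab : a < b) (hc : IsPath a b q₁ q₂ c) :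
    ContinuousOn (fun t => (c t).2.2 (velocity a b c t - (c t).2.1)) (Icc a b) := by
  -- the density without Lagrangian and potentials
  refine (hc.continuousOn_density hab (L := fun _ => 0) (γ := Fin.elim0)
    (w := Fin.elim0) contMDiff_const (fun i => i.elim0) (fun i => i.elim0)).congr fun t _ => ?_
  simp [density]

theorem continuousOn_lagrangian (hab : a < b) (hc : IsPath a b q₁ q₂ c)
    (hL : ContMDiff 𝓘(ℝ, E).tangent 𝓘(ℝ, ℝ) 2 L) :
    ContinuousOn (fun t => L ⟨(c t).proj, (c t).2.1⟩) (Icc a b) := by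
  refine ((hc.continuousOn_density hab hL (γ := Fin.elim0) (w := Fin.elim0) (fun i => i.elim0)
    (fun i => i.elim0)).sub (hc.continuousOn_pairing hab)).congr fun t _ => ?_
  simp [density]

theorem contDiffOn_potential (hc : IsPath a b q₁ q₂ c) {g : Q → ℝ}
    (hg : ContMDiff 𝓘(ℝ, E) 𝓘(ℝ, ℝ) 2 g) :
    ContDiffOn ℝ 1 (fun t => g (c t).proj) (Icc a b) := by
  rw [← contMDiffOn_iff_contDiffOn]
  exact (hg.of_le (by norm_num)).comp_contMDiffOn hc.contMDiffOn

theorem continuousOn_derivWithin_potential (hab : a < b) (hc : IsPath a b q₁ q₂ c) {g : Q → ℝ}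
    (hg : ContMDiff 𝓘(ℝ, E) 𝓘(ℝ, ℝ) 2 g) :
    ContinuousOn (derivWithin (fun t => g (c t).proj) (Icc a b)) (Icc a b) :=
  (hc.contDiffOn_potential hg).continuousOn_derivWithin (uniqueDiffOn_Icc hab) le_rfl

theorem hasPathIntegral_potential (hab : a < b) (hc : IsPath a b q₁ q₂ c) {g : Q → ℝ}
    (hg : ContMDiff 𝓘(ℝ, E) 𝓘(ℝ, ℝ) 2 g) {f : ℝ → ℝ} (hf : ContinuousOn f (Icc a b)) :
    HasPathIntegral (fun t => g (c t).proj) f a b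
      (g q₂ * f b - g q₁ * f a
        - ∫ t in a..b, f t * derivWithin (fun t => g (c t).proj) (Icc a b) t) := by
  have h := hasPathIntegral_of_hasDerivWithinAt hf
    (fun r hr => ((hc.contDiffOn_potential hg).differentiableOn one_ne_zero r hr).hasDerivWithinAt)
    (hc.continuousOn_derivWithin_potential hab hg)
  rwa [hc.left, hc.right] at h

/-- After integration by parts the stochastic terms only contribute boundary values, which are the
same for all curves in the path space, and an ordinary Lagrangian term. -/
theorem action_eq (hab : a < b) (hc : IsPath a b q₁ q₂ c)
    (hL : ContMDiff 𝓘(ℝ, E).tangent 𝓘(ℝ, ℝ) 2 L)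
    (hγ : ∀ i, ContMDiff 𝓘(ℝ, E) 𝓘(ℝ, ℝ) 2 (γ i)) (hw : ∀ i, ContinuousOn (w i) (Icc a b)) :
    action L γ w a b c
      = (∑ i, (γ i q₂ * w i b - γ i q₁ * w i a)) + ∫ t in a..b, density L γ w a b c t := by
  have hI : ∀ {f : ℝ → ℝ}, ContinuousOn f (Icc a b) → IntervalIntegrable f volume a b :=
    fun hf => ContinuousOn.intervalIntegrable (by rwa [uIcc_of_le hab.le])
  have h1 := hI (hc.continuousOn_lagrangian hab hL)
  have h2 := hI (hc.continuousOn_pairing hab)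
  have h3 : ∀ i, IntervalIntegrable
      (fun t => w i t * derivWithin (fun r => γ i (c r).proj) (Icc a b) t) volume a b :=
    fun i => hI ((hw i).mul (hc.continuousOn_derivWithin_potential hab (hγ i)))
  have h4 : ∀ i, pathIntegral (fun t => γ i (c t).proj) (w i) a b = _ := fun i =>
    pathIntegral_eq hab.le (hc.hasPathIntegral_potential hab (hγ i) (hw i))
  simp only [action, density]
  have h5 := IntervalIntegrable.sum Finset.univ fun i _ => h3 i
  rw [Finset.sum_fn] at h5
  rw [intervalIntegral.integral_sub (h1.add h2) h5, intervalIntegral.integral_add h1 h2,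
    intervalIntegral.integral_finsetSum fun i _ => h3 i]
  simp only [h4, Finset.sum_sub_distrib]
  ring

end IsPath

end

/-! ### Differentiation of the action along a family of curves -/

section

variable {E : Type*} [NormedAddCommGroup E] [NormedSpace ℝ E]
variable {Q : Type*} [TopologicalSpace Q] [ChartedSpace E Q]
variable [IsManifold 𝓘(ℝ, E) ((⊤ : ℕ∞) : WithTop ℕ∞) Q]
variable {m : ℕ} {a b : ℝ} {q₁ q₂ : Q} {Γ : ℝ → ℝ → PontryaginBundle E Q}
variable {L : TangentBundle 𝓘(ℝ, E) Q → ℝ} {γ : Fin m → Q → ℝ} {w : Fin m → ℝ → ℝ}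

theorem hasDerivAt_of_tendsto_inv_smul {X : Type*} [NormedAddCommGroup X] [NormedSpace ℝ X]
    {f : ℝ → X} {d : X} (h : Tendsto (fun ε => ε⁻¹ • (f ε - f 0)) (𝓝[≠] 0) (𝓝 d)) :
    HasDerivAt f d 0 := by
  rw [hasDerivAt_iff_tendsto_slope]
  refine h.congr fun ε => ?_
  simp [slope_def_module]

theorem IsPath.continuousOn_velocityChart_lift (hab : a < b) {c : ℝ → PontryaginBundle E Q}
    (hc : IsPath a b q₁ q₂ c) {x : Q} {U : Set ℝ} (hU : U ⊆ Icc a b)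
    (hx : ∀ t ∈ U, (c t).proj ∈ (chartAt E x).source) :
    ContinuousOn (fun t => velocityChart x (lift a b c t)) U := fun t ht =>
  (hc.continuousWithinAt_velocityChart_lift hab (hU ht) (hx t ht)).mono hU

theorem velocityChart_lift_mem {c : ℝ → PontryaginBundle E Q} {x : Q} {t : ℝ}
    (hx : (c t).proj ∈ (chartAt E x).source) :
    (velocityChart x (lift a b c t)).1 ∈ (extChartAt 𝓘(ℝ, E) x).target := by
  rw [velocityChart_lift hx, show pontryaginChart x (c t) = _ from
    pontryaginChart_apply hx (c t).2.1 (c t).2.2]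
  exact mem_target_of_mem_source hx

/-- A differentiable family in the chart in which it is differentiable near the time `t₀`; the
derivative `δ` is continuous, as a uniform limit of continuous difference quotients. -/
theorem DifferentiableFamily.exists_coord (hab : a < b)
    (hΓ : ∀ᶠ ε in 𝓝 (0 : ℝ), IsPath a b q₁ q₂ (Γ ε)) (hd : DifferentiableFamily a b Γ)
    {t₀ : ℝ} (ht₀ : t₀ ∈ Icc a b) :
    ∃ x : Q, ∃ U ∈ 𝓝[Icc a b] t₀, U ⊆ Icc a b ∧
      (∀ᶠ ε in 𝓝 (0 : ℝ), ∀ t ∈ U, (Γ ε t).proj ∈ (chartAt E x).source) ∧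
      ∃ δ : ℝ → E × (E × (E × (E →L[ℝ] ℝ))),
        TendstoUniformlyOn (fun ε t => ε⁻¹ • (velocityChart x (lift a b (Γ ε) t)
          - velocityChart x (lift a b (Γ 0) t))) δ (𝓝[≠] (0 : ℝ)) U ∧
        ContinuousOn δ U ∧
        ∀ t ∈ U, HasDerivAt (fun ε => velocityChart x (lift a b (Γ ε) t)) (δ t) 0 := by
  obtain ⟨x, U, hU, hsrc, δ, hδ⟩ := hd t₀ ht₀
  have hsrc' : ∀ᶠ ε in 𝓝 (0 : ℝ), ∀ t ∈ U ∩ Icc a b, (Γ ε t).proj ∈ (chartAt E x).source :=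
    hsrc.mono fun ε h t ht => mem_velocityChart_source.1 (h t ht.1)
  have hδ' := hδ.mono (inter_subset_left (t := Icc a b))
  refine ⟨x, U ∩ Icc a b, inter_mem hU self_mem_nhdsWithin, inter_subset_right, hsrc',
    δ, hδ', hδ'.continuousOn ?_, fun t ht => ?_⟩
  · have h0 := (hΓ.self_of_nhds).continuousOn_velocityChart_lift hab inter_subset_right
      hsrc'.self_of_nhds
    refine Eventually.frequently (eventually_nhdsWithin_of_eventually_nhds ?_)
    filter_upwards [hΓ, hsrc'] with ε h1 h2
    exact ((h1.continuousOn_velocityChart_lift hab inter_subset_right h2).sub h0).const_smul ε⁻¹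
  · exact hasDerivAt_of_tendsto_inv_smul (hδ'.tendsto_at ht)

theorem differentiableAt_localDensity (hL : ContMDiff 𝓘(ℝ, E).tangent 𝓘(ℝ, ℝ) 2 L)
    (hγ : ∀ i, ContMDiff 𝓘(ℝ, E) 𝓘(ℝ, ℝ) 2 (γ i)) {x : Q} {k : Fin m → ℝ}
    {z : E × (E × (E × (E →L[ℝ] ℝ)))} (hz : z.1 ∈ (extChartAt 𝓘(ℝ, E) x).target) :
    DifferentiableAt ℝ (localDensity L γ x k) z := by
  have h := ((contDiffOn_localDensity hL hγ x).contDiffAt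
    ((isOpen_preimage_target (m := m) x).mem_nhds (x := (k, z)) hz)).differentiableAt one_ne_zero
  exact h.comp z (f := fun z => (k, z)) (by fun_prop)

theorem DifferentiableFamily.differentiableAt_density (hab : a < b)
    (hΓ : ∀ᶠ ε in 𝓝 (0 : ℝ), IsPath a b q₁ q₂ (Γ ε)) (hd : DifferentiableFamily a b Γ)
    (hL : ContMDiff 𝓘(ℝ, E).tangent 𝓘(ℝ, ℝ) 2 L)
    (hγ : ∀ i, ContMDiff 𝓘(ℝ, E) 𝓘(ℝ, ℝ) 2 (γ i)) {t : ℝ} (ht : t ∈ Icc a b) :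
    DifferentiableAt ℝ (fun ε => density L γ w a b (Γ ε) t) 0 := by
  obtain ⟨x, U, hU, hUI, hsrc, δ, -, -, hder⟩ := hd.exists_coord hab hΓ ht
  have htU : t ∈ U := mem_of_mem_nhdsWithin ht hU
  have h := (differentiableAt_localDensity hL hγ (k := fun i => w i t)
    (velocityChart_lift_mem (a := a) (b := b) (hsrc.self_of_nhds t htU))).comp (0 : ℝ)
    (hder t htU).differentiableAt
  refine h.congr_of_eventuallyEq ?_
  filter_upwards [hΓ, hsrc] with ε h1 h2
  exact h1.density_eq_localDensity hab hγ ht (h2 t htU)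

/-- The density is Lipschitz in the parameter of the family at `0`, uniformly in the time. -/
theorem DifferentiableFamily.exists_lipschitz (hab : a < b)
    (hΓ : ∀ᶠ ε in 𝓝 (0 : ℝ), IsPath a b q₁ q₂ (Γ ε)) (hd : DifferentiableFamily a b Γ)
    (hL : ContMDiff 𝓘(ℝ, E).tangent 𝓘(ℝ, ℝ) 2 L)
    (hγ : ∀ i, ContMDiff 𝓘(ℝ, E) 𝓘(ℝ, ℝ) 2 (γ i)) (hw : ∀ i, ContinuousOn (w i) (Icc a b)) :
    ∃ C : ℝ, ∀ᶠ ε in 𝓝 (0 : ℝ), ∀ t ∈ Icc a b,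
      ‖density L γ w a b (Γ ε) t - density L γ w a b (Γ 0) t‖ ≤ C * ‖ε‖ := by
  refine isCompact_Icc.induction_on
    (p := fun S => ∃ C : ℝ, ∀ᶠ ε in 𝓝 (0 : ℝ), ∀ t ∈ S,
      ‖density L γ w a b (Γ ε) t - density L γ w a b (Γ 0) t‖ ≤ C * ‖ε‖) ⟨0, by simp⟩ ?_ ?_ ?_
  · rintro S T hST ⟨C, hC⟩
    exact ⟨C, hC.mono fun ε h t ht => h t (hST ht)⟩
  · rintro S T ⟨C, hC⟩ ⟨C', hC'⟩
    refine ⟨max C C', ?_⟩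
    filter_upwards [hC, hC'] with ε h h' t ht
    rcases ht with ht | ht
    · exact (h t ht).trans (mul_le_mul_of_nonneg_right (le_max_left _ _) (norm_nonneg _))
    · exact (h' t ht).trans (mul_le_mul_of_nonneg_right (le_max_right _ _) (norm_nonneg _))
  intro t₀ ht₀
  obtain ⟨x, U, hU, hUI, hsrc, δ, hδ, hδc, -⟩ := hd.exists_coord hab hΓ ht₀
  have ht₀U : t₀ ∈ U := mem_of_mem_nhdsWithin ht₀ hU
  have h0 := hΓ.self_of_nhds
  have hsrc0 := hsrc.self_of_nhds
  set z : ℝ → ℝ → E × (E × (E × (E →L[ℝ] ℝ))) := fun ε t => velocityChart x (lift a b (Γ ε) t)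
  set k : ℝ → Fin m → ℝ := fun t i => w i t
  -- As a `C¹` function of `(k, z)` the density is Lipschitz near `(w t₀, z 0 t₀)`. The time `t`
  -- enters only through `k = w t`, whose continuity keeps `(w t, z ε t)` in that neighbourhood for
  -- `t` close to `t₀` and small `ε`.
  obtain ⟨K, N, hN, hK⟩ := ((contDiffOn_localDensity hL hγ x).contDiffAt
    ((isOpen_preimage_target (m := m) x).mem_nhds (x := (k t₀, z 0 t₀))
      (velocityChart_lift_mem (hsrc0 t₀ ht₀U)))).exists_lipschitzOnWith
  obtain ⟨r, hr, hrN⟩ := Metric.mem_nhds_iff.1 hN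
  have hUn : 𝓝[U] t₀ = 𝓝[Icc a b] t₀ :=
    le_antisymm (nhdsWithin_mono _ hUI) (nhdsWithin_le_of_mem hU)
  have hkz : ContinuousWithinAt (fun t => (k t, z 0 t)) (Icc a b) t₀ :=
    (continuousWithinAt_pi.2 fun i => hw i t₀ ht₀).prodMk
      (h0.continuousWithinAt_velocityChart_lift hab ht₀ (hsrc0 t₀ ht₀U))
  have hδ0 : ContinuousWithinAt δ (Icc a b) t₀ := by
    have := hδc t₀ ht₀U
    rwa [ContinuousWithinAt, hUn] at this
  have e1 := hkz.eventually (Metric.ball_mem_nhds (k t₀, z 0 t₀) (half_pos hr))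
  have e2 := hδ0.norm.eventually_lt (continuousWithinAt_const (b := ‖δ t₀‖ + 1)) (lt_add_one _)
  set M := ‖δ t₀‖ + 2
  have hM : 0 < M := by positivity
  refine ⟨_, inter_mem hU (e1.and e2), K * M, ?_⟩
  have e3 := (Metric.tendstoUniformlyOn_iff.1 hδ) 1 one_pos
  rw [eventually_nhdsWithin_iff] at e3
  have e4 : ∀ᶠ ε in 𝓝 (0 : ℝ), M * ‖ε‖ < r / 2 := by
    have : Tendsto (fun ε : ℝ => M * ‖ε‖) (𝓝 0) (𝓝 0) := by
      simpa using (tendsto_norm_zero (E := ℝ)).const_mul M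
    exact this.eventually (gt_mem_nhds (half_pos hr))
  filter_upwards [e3, e4, hΓ, hsrc] with ε h3 h4 hp hs t ht
  obtain ⟨htU, ht1, ht2⟩ := ht
  have hzd : ‖z ε t - z 0 t‖ ≤ M * ‖ε‖ := by
    rcases eq_or_ne ε 0 with rfl | hε
    · simp
    · have h := h3 hε t htU
      rw [dist_comm, dist_eq_norm] at h
      have h' : ‖ε⁻¹ • (z ε t - z 0 t)‖ ≤ M := by
        have := norm_le_norm_add_norm_sub' (ε⁻¹ • (z ε t - z 0 t)) (δ t)
        have h'' : ‖ε⁻¹ • (z ε t - z 0 t) - δ t‖ < 1 := h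
        simp only [M]
        linarith
      rw [norm_smul, norm_inv, inv_mul_le_iff₀ (norm_pos_iff.2 hε)] at h'
      linarith
  have hm0 : (k t, z 0 t) ∈ N := hrN (Metric.ball_subset_ball (by linarith) ht1)
  have hmε : (k t, z ε t) ∈ N := by
    refine hrN ?_
    have hd1 : dist (k t, z ε t) (k t, z 0 t) ≤ M * ‖ε‖ := by
      rw [Prod.dist_eq, dist_self, dist_eq_norm, max_eq_right (norm_nonneg _)]
      exact hzd
    have hd2 : dist (k t, z 0 t) (k t₀, z 0 t₀) < r / 2 := ht1
    rw [Metric.mem_ball]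
    linarith [dist_triangle (k t, z ε t) (k t, z 0 t) (k t₀, z 0 t₀)]
  have h := hK.dist_le_mul _ hmε _ hm0
  rw [hp.density_eq_localDensity hab hγ (hUI htU) (hs t htU),
    h0.density_eq_localDensity hab hγ (hUI htU) (hsrc0 t htU), ← dist_eq_norm]
  refine h.trans ?_
  rw [Prod.dist_eq, dist_self, dist_eq_norm, max_eq_right (norm_nonneg _), mul_assoc]
  exact mul_le_mul_of_nonneg_left hzd K.2

/-- Differentiation of the action under the integral sign. A family is only required to be
differentiable at `ε = 0`, so dominated convergence rests on a Lipschitz bound at that point. -/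
theorem DifferentiableFamily.hasDerivAt_action (hab : a < b)
    (hΓ : ∀ᶠ ε in 𝓝 (0 : ℝ), IsPath a b q₁ q₂ (Γ ε)) (hd : DifferentiableFamily a b Γ)
    (hL : ContMDiff 𝓘(ℝ, E).tangent 𝓘(ℝ, ℝ) 2 L)
    (hγ : ∀ i, ContMDiff 𝓘(ℝ, E) 𝓘(ℝ, ℝ) 2 (γ i)) (hw : ∀ i, ContinuousOn (w i) (Icc a b)) :
    IntervalIntegrable (fun t => deriv (fun ε => density L γ w a b (Γ ε) t) 0) volume a b ∧
    HasDerivAt (fun ε => action L γ w a b (Γ ε))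
      (∫ t in a..b, deriv (fun ε => density L γ w a b (Γ ε) t) 0) 0 := by
  set F : ℝ → ℝ → ℝ := fun ε t => density L γ w a b (Γ ε) t with hF
  set D : ℝ → ℝ := fun t => deriv (fun ε => density L γ w a b (Γ ε) t) 0 with hD
  obtain ⟨C, hC⟩ := hd.exists_lipschitz hab hΓ hL hγ hw
  have hcont : ∀ᶠ ε in 𝓝 (0 : ℝ), ContinuousOn (F ε) (Icc a b) :=
    hΓ.mono fun ε h => h.continuousOn_density hab hL hγ hw
  have hmeas : ∀ {ε}, ContinuousOn (F ε) (Icc a b) →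
      AEStronglyMeasurable (F ε) (volume.restrict (Ioc a b)) := fun h =>
    (h.mono Ioc_subset_Icc_self).aestronglyMeasurable measurableSet_Ioc
  have hder : ∀ t ∈ Icc a b, HasDerivAt (fun ε => F ε t) (D t) 0 := fun t ht =>
    (hd.differentiableAt_density hab hΓ hL hγ ht).hasDerivAt
  -- the derivative is a pointwise limit of a sequence of continuous difference quotients
  have hDmeas : AEStronglyMeasurable D (volume.restrict (Ioc a b)) := by
    obtain ⟨u, hu⟩ := exists_seq_tendsto (𝓝[≠] (0 : ℝ))
    have hev := hu.eventually (eventually_nhdsWithin_of_eventually_nhds hcont)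
    obtain ⟨N, hN⟩ := eventually_atTop.1 hev
    refine aestronglyMeasurable_of_tendsto_ae atTop
      (f := fun n t => slope (fun ε => F ε t) 0 (u (n + N))) (fun n => ?_) ?_
    · simp only [slope_def_module]
      exact ((hmeas (hN (n + N) (Nat.le_add_left _ _))).sub
        (hmeas hcont.self_of_nhds)).const_smul (u (n + N) - 0)⁻¹
    · refine (ae_restrict_iff' measurableSet_Ioc).2 (Eventually.of_forall fun t ht => ?_)
      exact ((hder t (Ioc_subset_Icc_self ht)).tendsto_slope.comp hu).comp
        (tendsto_add_atTop_nat N)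
  have key := hasFDerivAt_integral_of_dominated_loc_of_lip' (𝕜 := ℝ)
    (μ := volume.restrict (Ioc a b)) (F := F) (x₀ := 0) (bound := fun _ => C)
    (F' := fun t => ContinuousLinearMap.toSpanSingleton ℝ (D t)) (hcont.and hC)
    (fun ε h => hmeas h.1)
    (hcont.self_of_nhds.integrableOn_Icc.mono_set Ioc_subset_Icc_self)
    ((ContinuousLinearMap.toSpanSingletonLIE ℝ ℝ).continuous.comp_aestronglyMeasurable hDmeas)
    ((ae_restrict_iff' measurableSet_Ioc).2 (Eventually.of_forall fun t ht ε h => by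
      simpa using h.2 t (Ioc_subset_Icc_self ht)))
    (integrable_const C)
    ((ae_restrict_iff' measurableSet_Ioc).2 (Eventually.of_forall fun t ht =>
      (hder t (Ioc_subset_Icc_self ht)).hasFDerivAt))
  have hDint : Integrable D (volume.restrict (Ioc a b)) := by
    simpa using (ContinuousLinearMap.apply ℝ ℝ (1 : ℝ)).integrable_comp key.1
  refine ⟨(intervalIntegrable_iff_integrableOn_Ioc_of_le hab.le).2 hDint, ?_⟩
  have h2 := key.2.hasDerivAt
  rw [ContinuousLinearMap.integral_apply key.1] at h2
  simp only [ContinuousLinearMap.toSpanSingleton_apply, one_smul] at h2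
  rw [intervalIntegral.integral_of_le hab.le]
  refine (h2.const_add (∑ i, (γ i q₂ * w i b - γ i q₁ * w i a))).congr_of_eventuallyEq ?_
  filter_upwards [hΓ] with ε h
  rw [h.action_eq hab hL hγ hw, intervalIntegral.integral_of_le hab.le]

end

/-! ### The first variation and the equations in coordinates -/

section

variable {E : Type*} [NormedAddCommGroup E] [NormedSpace ℝ E]
variable {Q : Type*} [TopologicalSpace Q] [ChartedSpace E Q]
variable {m : ℕ} 
/-- The momentum corrected by the stochastic terms, `p - ∑ᵢ kᵢ dγᵢ`, in the chart at `x`. Along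
solutions of the stochastic equations it is of class `C¹`. -/
def reducedMomentum (γ : Fin m → Q → ℝ) (x : Q) (k : Fin m → ℝ)
    (z : E × (E × (E × (E →L[ℝ] ℝ)))) : E →L[ℝ] ℝ :=
  z.2.2.2 - ∑ i, k i • fderiv ℝ (localPotential E (γ i) x) z.1

variable [IsManifold 𝓘(ℝ, E) ((⊤ : ℕ∞) : WithTop ℕ∞) Q]

/-- The right-hand side `∂L/∂q - ∑ᵢ kᵢ D²γᵢ(dq/dt, ·)` of the equation of motion of the reduced
momentum, in the chart at `x`. -/
def force (L : TangentBundle 𝓘(ℝ, E) Q → ℝ) (γ : Fin m → Q → ℝ) (x : Q) (k : Fin m → ℝ)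
    (z : E × (E × (E × (E →L[ℝ] ℝ)))) : E →L[ℝ] ℝ :=
  (fderiv ℝ (localLagrangian L x) (z.1, z.2.2.1)).comp (ContinuousLinearMap.inl ℝ E E)
    - ∑ i, k i • fderiv ℝ (fderiv ℝ (localPotential E (γ i) x)) z.1 z.2.1

variable {a b : ℝ} {q₁ q₂ : Q} {c : ℝ → PontryaginBundle E Q}
variable {L : TangentBundle 𝓘(ℝ, E) Q → ℝ} {γ : Fin m → Q → ℝ} {w : Fin m → ℝ → ℝ}

theorem differentiableAt_localLagrangian (hL : ContMDiff 𝓘(ℝ, E).tangent 𝓘(ℝ, ℝ) 2 L) {x : Q}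
    {y : E × E} (hy : y.1 ∈ (extChartAt 𝓘(ℝ, E) x).target) :
    DifferentiableAt ℝ (localLagrangian L x) y :=
  ((contDiffOn_localLagrangian hL x).contDiffAt
    (((isOpen_extChartAt_target x).prod isOpen_univ).mem_nhds ⟨hy, mem_univ _⟩)).differentiableAt
    two_ne_zero

theorem hasFDerivAt_fderiv_localPotential {g : Q → ℝ} (hg : ContMDiff 𝓘(ℝ, E) 𝓘(ℝ, ℝ) 2 g)
    {x : Q} {y : E} (hy : y ∈ (extChartAt 𝓘(ℝ, E) x).target) :
    HasFDerivAt (fderiv ℝ (localPotential E g x))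
      (fderiv ℝ (fderiv ℝ (localPotential E g x)) y) y :=
  (((contDiffOn_fderiv_localPotential hg x).contDiffAt
    ((isOpen_extChartAt_target x).mem_nhds hy)).differentiableAt one_ne_zero).hasFDerivAt

/-- The first variation of the density, in coordinates. The symmetry of the second derivatives of
the `γᵢ` is what collects the terms in `δq` into the force. -/
theorem hasDerivAt_localDensity (hL : ContMDiff 𝓘(ℝ, E).tangent 𝓘(ℝ, ℝ) 2 L)
    (hγ : ∀ i, ContMDiff 𝓘(ℝ, E) 𝓘(ℝ, ℝ) 2 (γ i)) {x : Q} {k : Fin m → ℝ}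
    {z : ℝ → E × (E × (E × (E →L[ℝ] ℝ)))} {δ : E × (E × (E × (E →L[ℝ] ℝ)))}
    (hx : (z 0).1 ∈ (extChartAt 𝓘(ℝ, E) x).target) (hz : HasDerivAt z δ 0) :
    HasDerivAt (fun ε => localDensity L γ x k (z ε))
      (force L γ x k (z 0) δ.1 + reducedMomentum γ x k (z 0) δ.2.1
        + (fderiv ℝ (localLagrangian L x) ((z 0).1, (z 0).2.2.1) (0, δ.2.2.1)
            - (z 0).2.2.2 δ.2.2.1)
        + δ.2.2.2 ((z 0).2.1 - (z 0).2.2.1)) 0 := by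
  have hy : HasDerivAt (fun ε => (z ε).1) δ.1 0 := hz.fst
  have hu : HasDerivAt (fun ε => (z ε).2.1) δ.2.1 0 := hz.snd.fst
  have hv : HasDerivAt (fun ε => (z ε).2.2.1) δ.2.2.1 0 := hz.snd.snd.fst
  have hp : HasDerivAt (fun ε => (z ε).2.2.2) δ.2.2.2 0 := hz.snd.snd.snd
  have h1 : HasDerivAt (fun ε => localLagrangian L x ((z ε).1, (z ε).2.2.1))
      (fderiv ℝ (localLagrangian L x) ((z 0).1, (z 0).2.2.1) (δ.1, δ.2.2.1)) 0 :=
    (differentiableAt_localLagrangian hL (y := ((z 0).1, (z 0).2.2.1))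
      hx).hasFDerivAt.comp_hasDerivAt (0 : ℝ) (f := fun ε => ((z ε).1, (z ε).2.2.1)) (hy.prodMk hv)
  have h2 := hp.clm_apply (hu.fun_sub hv)
  have h3 : HasDerivAt (fun ε => ∑ i, k i * fderiv ℝ (localPotential E (γ i) x) (z ε).1 (z ε).2.1)
      (∑ i, k i * (fderiv ℝ (fderiv ℝ (localPotential E (γ i) x)) (z 0).1 δ.1 (z 0).2.1
        + fderiv ℝ (localPotential E (γ i) x) (z 0).1 δ.2.1)) 0 := by
    refine HasDerivAt.fun_sum fun i _ => HasDerivAt.const_mul (k i) ?_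
    have h : HasDerivAt (fun ε => fderiv ℝ (localPotential E (γ i) x) (z ε).1)
        (fderiv ℝ (fderiv ℝ (localPotential E (γ i) x)) (z 0).1 δ.1) 0 :=
      (hasFDerivAt_fderiv_localPotential (hγ i) hx).comp_hasDerivAt (0 : ℝ) hy
    exact h.clm_apply hu
  have hsymm : ∀ i, fderiv ℝ (fderiv ℝ (localPotential E (γ i) x)) (z 0).1 δ.1 (z 0).2.1
      = fderiv ℝ (fderiv ℝ (localPotential E (γ i) x)) (z 0).1 (z 0).2.1 δ.1 := fun i =>
    ((((contDiffOn_localPotential (hγ i) x).contDiffAt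
      ((isOpen_extChartAt_target x).mem_nhds hx)).isSymmSndFDerivAt (by simp)).eq _ _)
  unfold localDensity
  refine ((h1.fun_add h2).fun_sub h3).congr_deriv ?_
  have hsplit : fderiv ℝ (localLagrangian L x) ((z 0).1, (z 0).2.2.1) (δ.1, δ.2.2.1)
      = fderiv ℝ (localLagrangian L x) ((z 0).1, (z 0).2.2.1) (δ.1, 0)
        + fderiv ℝ (localLagrangian L x) ((z 0).1, (z 0).2.2.1) (0, δ.2.2.1) := by
    rw [← map_add]; simp
  simp only [hsymm, hsplit, force, reducedMomentum, mul_add, Finset.sum_add_distrib, map_sub,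
    sub_apply, ContinuousLinearMap.comp_apply, ContinuousLinearMap.inl_apply,
    sum_apply, smul_apply, smul_eq_mul]
  ring

/-- The Legendre condition `p = ∂L/∂v` in coordinates. The tangent space at `q` is identified with
the model space, as in its definition. -/
theorem legendre_iff (hL : ContMDiff 𝓘(ℝ, E).tangent 𝓘(ℝ, ℝ) 2 L) {x q : Q}
    (hq : q ∈ (chartAt E x).source) (v : TangentSpace 𝓘(ℝ, E) q) (p : Cotangent E q) :
    p = fderiv ℝ (fun u : TangentSpace 𝓘(ℝ, E) q => L ⟨q, u⟩) v ↔
      ∀ e : E, p (tangentCoordSymm x q e)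
        = fderiv ℝ (localLagrangian L x) (extChartAt 𝓘(ℝ, E) x q, tangentCoord x q v) (0, e) := by
  have h1 : HasFDerivAt (fun u : E => L ⟨q, u⟩)
      ((fderiv ℝ (localLagrangian L x) (extChartAt 𝓘(ℝ, E) x q, tangentCoord x q v)).comp
        ((0 : E →L[ℝ] E).prod (show E →L[ℝ] E from tangentCoord x q))) v := by
    have h := (differentiableAt_localLagrangian hL
      (y := (extChartAt 𝓘(ℝ, E) x q, tangentCoord x q v))
      (mem_target_of_mem_source hq)).hasFDerivAt.comp (v : E)
      (f := fun u : E => (extChartAt 𝓘(ℝ, E) x q, (show E →L[ℝ] E from tangentCoord x q) u))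
      ((hasFDerivAt_const _ _).prodMk (show E →L[ℝ] E from tangentCoord x q).hasFDerivAt)
    refine h.congr_of_eventuallyEq (Eventually.of_forall fun u => ?_)
    exact (localLagrangian_apply L hq u).symm
  have h2 := h1.fderiv
  constructor
  · rintro rfl e
    refine (congrArg (fun A : E →L[ℝ] ℝ => A (tangentCoordSymm x q e)) h2).trans ?_
    change fderiv ℝ (localLagrangian L x) _ (0, tangentCoord x q (tangentCoordSymm x q e)) = _
    rw [tangentCoord_symm hq]
  · intro h
    refine Eq.trans (b := _) ?_ h2.symm
    refine ContinuousLinearMap.ext fun u => ?_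
    change p u = fderiv ℝ (localLagrangian L x) _ (0, tangentCoord x q u)
    rw [← h, tangentCoordSymm_apply hq]

namespace IsPath

theorem continuousOn_reducedMomentum (hab : a < b) (hc : IsPath a b q₁ q₂ c)
    (hγ : ∀ i, ContMDiff 𝓘(ℝ, E) 𝓘(ℝ, ℝ) 2 (γ i)) (hw : ∀ i, ContinuousOn (w i) (Icc a b))
    {x : Q} {U : Set ℝ} (hU : U ⊆ Icc a b) (hx : ∀ t ∈ U, (c t).proj ∈ (chartAt E x).source) :
    ContinuousOn (fun t => reducedMomentum γ x (fun i => w i t) (velocityChart x (lift a b c t)))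
      U := by
  have hz := hc.continuousOn_velocityChart_lift hab hU hx
  refine hz.snd.snd.snd.sub (continuousOn_finsetSum _ fun i _ => ((hw i).mono hU).smul ?_)
  exact (contDiffOn_fderiv_localPotential (hγ i) x).continuousOn.comp hz.fst
    fun t ht => velocityChart_lift_mem (hx t ht)

theorem continuousOn_force (hab : a < b) (hc : IsPath a b q₁ q₂ c)
    (hL : ContMDiff 𝓘(ℝ, E).tangent 𝓘(ℝ, ℝ) 2 L)
    (hγ : ∀ i, ContMDiff 𝓘(ℝ, E) 𝓘(ℝ, ℝ) 2 (γ i)) (hw : ∀ i, ContinuousOn (w i) (Icc a b))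
    {x : Q} {U : Set ℝ} (hU : U ⊆ Icc a b) (hx : ∀ t ∈ U, (c t).proj ∈ (chartAt E x).source) :
    ContinuousOn (fun t => force L γ x (fun i => w i t) (velocityChart x (lift a b c t))) U := by
  have hz := hc.continuousOn_velocityChart_lift hab hU hx
  have hm : ∀ t ∈ U, (velocityChart x (lift a b c t)).1 ∈ (extChartAt 𝓘(ℝ, E) x).target :=
    fun t ht => velocityChart_lift_mem (hx t ht)
  refine ContinuousOn.sub (ContinuousOn.clm_comp ?_ continuousOn_const)
    (continuousOn_finsetSum _ fun i _ => ((hw i).mono hU).smul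
      (ContinuousOn.clm_apply ?_ hz.snd.fst))
  · exact ((contDiffOn_localLagrangian hL x).continuousOn_fderiv_of_isOpen
      ((isOpen_extChartAt_target x).prod isOpen_univ) (by norm_num)).comp
      (hz.fst.prodMk hz.snd.snd.fst) fun t ht => ⟨hm t ht, mem_univ _⟩
  · exact ((contDiffOn_fderiv_localPotential (hγ i) x).continuousOn_fderiv_of_isOpen
      (isOpen_extChartAt_target x) le_rfl).comp hz.fst hm

/-- The momentum equation over `[s, t]`, freed from stochastic integrals by partial integration. -/
theorem momentum_iff (hab : a < b) (hc : IsPath a b q₁ q₂ c)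
    (hL : ContMDiff 𝓘(ℝ, E).tangent 𝓘(ℝ, ℝ) 2 L)
    (hγ : ∀ i, ContMDiff 𝓘(ℝ, E) 𝓘(ℝ, ℝ) 2 (γ i)) (hw : ∀ i, ContinuousOn (w i) (Icc a b))
    {x : Q} {s t : ℝ} (has : a ≤ s) (hst : s ≤ t) (htb : t ≤ b)
    (hx : ∀ r ∈ Icc s t, (c r).proj ∈ (chartAt E x).source) (e : E) :
    (∃ S : Fin m → ℝ,
      (∀ i, HasPathIntegral
        (fun r => fderiv ℝ (fun y => γ i ((extChartAt 𝓘(ℝ, E) x).symm y))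
          (extChartAt 𝓘(ℝ, E) x (c r).proj) e) (w i) s t (S i)) ∧
      (pontryaginChart x (c t)).2.2 e - (pontryaginChart x (c s)).2.2 e =
        (∫ r in s..t,
          fderiv ℝ (fun y => L ((tangentChart x).symm (y, (pontryaginChart x (c r)).2.1)))
          (pontryaginChart x (c r)).1 e) + ∑ i, S i) ↔
    (reducedMomentum γ x (fun i => w i t) (velocityChart x (lift a b c t))
      - reducedMomentum γ x (fun i => w i s) (velocityChart x (lift a b c s))) e
      = ∫ r in s..t, force L γ x (fun i => w i r) (velocityChart x (lift a b c r)) e := by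
  have hsub : Icc s t ⊆ Icc a b := Icc_subset_Icc has htb
  set z : ℝ → E × (E × (E × (E →L[ℝ] ℝ))) := fun r => velocityChart x (lift a b c r) with hzdef
  have hz : ContinuousOn z (Icc s t) := hc.continuousOn_velocityChart_lift hab hsub hx
  have hm : ∀ r ∈ Icc s t, (z r).1 ∈ (extChartAt 𝓘(ℝ, E) x).target :=
    fun r hr => velocityChart_lift_mem (hx r hr)
  have hpz : ∀ r ∈ Icc s t, pontryaginChart x (c r) = ((z r).1, (z r).2.2) := fun r hr => by
    simp only [hzdef]
    rw [velocityChart_lift (hx r hr)]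
  have hqz : ∀ r ∈ Icc s t, extChartAt 𝓘(ℝ, E) x (c r).proj = (z r).1 := fun r hr => by
    have := congrArg Prod.fst (hpz r hr)
    rwa [show pontryaginChart x (c r) = _ from
      pontryaginChart_apply (hx r hr) (c r).2.1 (c r).2.2] at this
  have hs : s ∈ Icc s t := left_mem_Icc.2 hst
  have ht : t ∈ Icc s t := right_mem_Icc.2 hst
  have hzd : ∀ r ∈ Icc s t, HasDerivWithinAt (fun r => (z r).1) (z r).2.1 (Icc s t) r := by
    intro r hr
    have h := (hc.hasDerivWithinAt_coord (hsub hr) (hx r hr)).mono hsub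
    have h' : (z r).2.1 = tangentCoord x (c r).proj (velocity a b c r) := by
      simp only [hzdef]
      rw [velocityChart_lift (hx r hr)]
    rw [h']
    exact h.congr_of_mem (fun r' hr' => (hqz r' hr').symm) hr
  -- the integrand `∂γᵢ/∂q` and its derivative along the curve
  set G : Fin m → ℝ → ℝ := fun i r => fderiv ℝ (localPotential E (γ i) x) (z r).1 e with hG
  set G' : Fin m → ℝ → ℝ := fun i r =>
    fderiv ℝ (fderiv ℝ (localPotential E (γ i) x)) (z r).1 (z r).2.1 e with hG'
  have hGd : ∀ i, ∀ r ∈ Icc s t, HasDerivWithinAt (G i) (G' i r) (Icc s t) r := fun i r hr => by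
    have h : HasDerivWithinAt (fun r => fderiv ℝ (localPotential E (γ i) x) (z r).1)
        (fderiv ℝ (fderiv ℝ (localPotential E (γ i) x)) (z r).1 (z r).2.1) (Icc s t) r :=
      (hasFDerivAt_fderiv_localPotential (hγ i) (hm r hr)).comp_hasDerivWithinAt r (hzd r hr)
    simpa using h.clm_apply (hasDerivWithinAt_const r (Icc s t) e)
  have hG'c : ∀ i, ContinuousOn (G' i) (Icc s t) := fun i =>
    ((((contDiffOn_fderiv_localPotential (hγ i) x).continuousOn_fderiv_of_isOpen
      (isOpen_extChartAt_target x) le_rfl).comp hz.fst hm).clm_apply hz.snd.fst).clm_apply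
      continuousOn_const
  have hJ : ∀ i, HasPathIntegral (fun r => fderiv ℝ (fun y => γ i ((extChartAt 𝓘(ℝ, E) x).symm y))
      (extChartAt 𝓘(ℝ, E) x (c r).proj) e) (w i) s t
      (G i t * w i t - G i s * w i s - ∫ r in s..t, w i r * G' i r) := by
    intro i
    refine hasPathIntegral_of_hasDerivWithinAt ((hw i).mono hsub) (hGd i) (hG'c i) |>.congr
      fun π => ?_
    refine Finset.sum_congr rfl fun k hk => ?_
    rw [Finset.mem_range] at hk
    simp only [hG]
    rw [← hqz _ (π.node_mem_Icc hk.le), ← hqz _ (π.node_mem_Icc hk)]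
    rfl
  have hne := neBot_meshToZero hst
  have hleft : (∃ S : Fin m → ℝ,
      (∀ i, HasPathIntegral
        (fun r => fderiv ℝ (fun y => γ i ((extChartAt 𝓘(ℝ, E) x).symm y))
          (extChartAt 𝓘(ℝ, E) x (c r).proj) e) (w i) s t (S i)) ∧
      (pontryaginChart x (c t)).2.2 e - (pontryaginChart x (c s)).2.2 e =
        (∫ r in s..t,
          fderiv ℝ (fun y => L ((tangentChart x).symm (y, (pontryaginChart x (c r)).2.1)))
          (pontryaginChart x (c r)).1 e) + ∑ i, S i) ↔
      (pontryaginChart x (c t)).2.2 e - (pontryaginChart x (c s)).2.2 e =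
        (∫ r in s..t,
          fderiv ℝ (fun y => L ((tangentChart x).symm (y, (pontryaginChart x (c r)).2.1)))
          (pontryaginChart x (c r)).1 e)
        + ∑ i, (G i t * w i t - G i s * w i s - ∫ r in s..t, w i r * G' i r) := by
    constructor
    · rintro ⟨S, hS, h⟩
      rw [h, Finset.sum_congr rfl fun i _ => tendsto_nhds_unique (hS i) (hJ i)]
    · exact fun h => ⟨_, hJ, h⟩
  have hℓ : (∫ r in s..t,
      fderiv ℝ (fun y => L ((tangentChart x).symm (y, (pontryaginChart x (c r)).2.1)))
          (pontryaginChart x (c r)).1 e)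
      = ∫ r in s..t, fderiv ℝ (localLagrangian L x) ((z r).1, (z r).2.2.1) (e, 0) := by
    refine intervalIntegral.integral_congr fun r hr => ?_
    rw [uIcc_of_le hst] at hr
    have h := ((differentiableAt_localLagrangian hL (y := ((z r).1, (z r).2.2.1))
      (hm r hr)).hasFDerivAt.comp (z r).1 (f := fun y : E => (y, (z r).2.2.1))
      ((hasFDerivAt_id _).prodMk (hasFDerivAt_const _ _))).fderiv
    simp only [hpz r hr]
    exact congrArg (fun A : E →L[ℝ] ℝ => A e) h
  have hℓc : ContinuousOn
      (fun r => fderiv ℝ (localLagrangian L x) ((z r).1, (z r).2.2.1) (e, 0)) (Icc s t) :=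
    (((contDiffOn_localLagrangian hL x).continuousOn_fderiv_of_isOpen
      ((isOpen_extChartAt_target x).prod isOpen_univ) (by norm_num)).comp
      (hz.fst.prodMk hz.snd.snd.fst) fun r hr => ⟨hm r hr, mem_univ _⟩).clm_apply continuousOn_const
  have hI : ∀ {f : ℝ → ℝ}, ContinuousOn f (Icc s t) → IntervalIntegrable f volume s t :=
    fun hf => ContinuousOn.intervalIntegrable (by rwa [uIcc_of_le hst])
  have hwG : ∀ i, IntervalIntegrable (fun r => w i r * G' i r) volume s t :=
    fun i => hI (((hw i).mono hsub).mul (hG'c i))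
  have hsum := IntervalIntegrable.sum Finset.univ fun i _ => hwG i
  rw [Finset.sum_fn] at hsum
  have hforce : (∫ r in s..t, force L γ x (fun i => w i r) (z r) e)
      = (∫ r in s..t, fderiv ℝ (localLagrangian L x) ((z r).1, (z r).2.2.1) (e, 0))
        - ∑ i, ∫ r in s..t, w i r * G' i r := by
    rw [← intervalIntegral.integral_finsetSum fun i _ => hwG i,
      ← intervalIntegral.integral_sub (hI hℓc) hsum]
    simp [force, hG']
  rw [hleft, hℓ, hforce, hpz t ht, hpz s hs]
  simp only [reducedMomentum, sub_apply, sum_apply,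
    smul_apply, smul_eq_mul, Finset.sum_sub_distrib, hG, mul_comm]
  constructor <;> intro h <;> linarith

end IsPath

end

/-! ### Solutions are critical points -/

section

variable {E : Type*} [NormedAddCommGroup E] [NormedSpace ℝ E]
variable {Q : Type*} [TopologicalSpace Q] [ChartedSpace E Q]
variable {m : ℕ} {a b : ℝ} {q₁ q₂ : Q} {c : ℝ → PontryaginBundle E Q}
variable {L : TangentBundle 𝓘(ℝ, E) Q → ℝ} {γ : Fin m → Q → ℝ} {w : Fin m → ℝ → ℝ}

/-- Curves which agree near `t` within `[a, b]` have the same position, velocity and fibre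
components at `t`. -/
theorem lift_eq_of_eventuallyEq {c c' : ℝ → PontryaginBundle E Q} {t : ℝ}
    (h : c =ᶠ[𝓝[Icc a b] t] c') (ht : t ∈ Icc a b) : lift a b c t = lift a b c' t := by
  have htt : c t = c' t := h.self_of_nhdsWithin ht
  have hv : (velocity a b c t : E) = velocity a b c' t :=
    congrArg (fun A : ℝ →L[ℝ] E => A 1)
      (Filter.EventuallyEq.mfderivWithin_eq (I := 𝓘(ℝ, ℝ)) (I' := 𝓘(ℝ, E))
        (f := fun r => (c' r).proj) (f₁ := fun r => (c r).proj)
        (h.mono fun r hr => congrArg Bundle.TotalSpace.proj hr)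
        (congrArg Bundle.TotalSpace.proj htt))
  have key : ∀ (z z' : PontryaginBundle E Q) (u u' : E), z = z' → u = u' →
      (⟨z.proj, (u, z.2)⟩ : VelocityBundle E Q) = ⟨z'.proj, (u', z'.2)⟩ := by
    rintro z _ u _ rfl rfl
    rfl
  exact key _ _ _ _ htt hv

theorem lift_congr {c c' : ℝ → PontryaginBundle E Q} (h : EqOn c c' (Icc a b)) :
    EqOn (lift a b c) (lift a b c') (Icc a b) := fun _ ht =>
  lift_eq_of_eventuallyEq (h.eventuallyEq_of_mem self_mem_nhdsWithin) ht

variable {Γ : ℝ → ℝ → PontryaginBundle E Q}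

/-- The boundary term `⟨p, δq⟩ - ∑ᵢ wᵢ dγᵢ(δq)` of the first variation along the family `Γ`. -/
def boundaryTerm (γ : Fin m → Q → ℝ) (w : Fin m → ℝ → ℝ) (Γ : ℝ → ℝ → PontryaginBundle E Q)
    (t : ℝ) : ℝ :=
  (Γ 0 t).2.2 (mfderiv 𝓘(ℝ, ℝ) 𝓘(ℝ, E) (fun ε => (Γ ε t).proj) 0 (1 : ℝ))
    - ∑ i, w i t * deriv (fun ε => γ i (Γ ε t).proj) 0

theorem boundaryTerm_eq_zero {t : ℝ} {q : Q} (h : ∀ᶠ ε in 𝓝 (0 : ℝ), (Γ ε t).proj = q) :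
    boundaryTerm γ w Γ t = 0 := by
  have h1 : mfderiv 𝓘(ℝ, ℝ) 𝓘(ℝ, E) (fun ε => (Γ ε t).proj) 0
      = (0 : ℝ →L[ℝ] E) := by
    refine Eq.trans (Filter.EventuallyEq.mfderiv_eq (f := fun _ => q) h) ?_
    exact mfderiv_const
  have h2 : ∀ i, deriv (fun ε => γ i (Γ ε t).proj) 0 = 0 := fun i => by
    have : (fun ε => γ i (Γ ε t).proj) =ᶠ[𝓝 0] fun _ => γ i q :=
      h.mono fun ε hε => congrArg (γ i) hε
    rw [this.deriv_eq, deriv_const]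
  have h3 : (Γ 0 t).2.2 (mfderiv 𝓘(ℝ, ℝ) 𝓘(ℝ, E) (fun ε => (Γ ε t).proj) 0 (1 : ℝ)) = 0 := by
    refine Eq.trans (congrArg (fun A : ℝ →L[ℝ] E => (Γ 0 t).2.2 (A 1)) h1) ?_
    exact map_zero _
  simp [boundaryTerm, h2, h3]

variable [IsManifold 𝓘(ℝ, E) ((⊤ : ℕ∞) : WithTop ℕ∞) Q]

/-- The Hamilton–Pontryagin equations for a curve `ζ = (q, dq/dt, v, p)` in coordinates. The
momentum equation is the one for the reduced momentum, which involves no stochastic integral. -/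
structure IsLocalSolution (L : TangentBundle 𝓘(ℝ, E) Q → ℝ) (γ : Fin m → Q → ℝ)
    (w : Fin m → ℝ → ℝ) (a b : ℝ) (ζ : ℝ → VelocityBundle E Q) : Prop where
  kinematic : ∀ t ∈ Icc a b, ∀ x, (ζ t).proj ∈ (chartAt E x).source →
    (velocityChart x (ζ t)).2.1 = (velocityChart x (ζ t)).2.2.1
  legendre : ∀ t ∈ Icc a b, ∀ x, (ζ t).proj ∈ (chartAt E x).source → ∀ e : E,
    (velocityChart x (ζ t)).2.2.2 e
      = fderiv ℝ (localLagrangian L x) ((velocityChart x (ζ t)).1, (velocityChart x (ζ t)).2.2.1)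
          (0, e)
  momentum : ∀ (x : Q) (s t : ℝ), a ≤ s → s ≤ t → t ≤ b →
    (∀ r ∈ Icc s t, (ζ r).proj ∈ (chartAt E x).source) →
    reducedMomentum γ x (fun i => w i t) (velocityChart x (ζ t))
      - reducedMomentum γ x (fun i => w i s) (velocityChart x (ζ s))
      = ∫ r in s..t, force L γ x (fun i => w i r) (velocityChart x (ζ r))

theorem IsLocalSolution.congr {ζ ζ' : ℝ → VelocityBundle E Q}
    (h : IsLocalSolution L γ w a b ζ) (hζ : EqOn ζ' ζ (Icc a b)) :
    IsLocalSolution L γ w a b ζ' where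
  kinematic t ht := by simpa only [hζ ht] using h.kinematic t ht
  legendre t ht := by simpa only [hζ ht] using h.legendre t ht
  momentum x s t has hst htb hx := by
    have hsub : Icc s t ⊆ Icc a b := Icc_subset_Icc has htb
    rw [hζ (hsub (left_mem_Icc.2 hst)), hζ (hsub (right_mem_Icc.2 hst)),
      h.momentum x s t has hst htb fun r hr => by rw [← hζ (hsub hr)]; exact hx r hr]
    refine intervalIntegral.integral_congr fun r hr => ?_
    rw [uIcc_of_le hst] at hr
    simp only [hζ (hsub hr)]

/-- The equations hold if and only if they hold in coordinates: `legendre_iff` and `momentum_iff`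
translate the second and the third of them. -/
theorem IsPath.solvesHP_iff (hab : a < b) (hc : IsPath a b q₁ q₂ c)
    (hL : ContMDiff 𝓘(ℝ, E).tangent 𝓘(ℝ, ℝ) 2 L)
    (hγ : ∀ i, ContMDiff 𝓘(ℝ, E) 𝓘(ℝ, ℝ) 2 (γ i)) (hw : ∀ i, ContinuousOn (w i) (Icc a b)) :
    SolvesHP L γ w a b c ↔ IsLocalSolution L γ w a b (lift a b c) := by
  have hz : ∀ {t : ℝ} {x : Q}, (c t).proj ∈ (chartAt E x).source →
      velocityChart x (lift a b c t) = (extChartAt 𝓘(ℝ, E) x (c t).proj,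
        (tangentCoord x (c t).proj (velocity a b c t), (tangentCoord x (c t).proj (c t).2.1,
          (c t).2.2.comp (tangentCoordSymm x (c t).proj)))) := fun hx =>
    velocityChart_apply hx _ _ _
  have hint : ∀ {x : Q} {s t : ℝ}, a ≤ s → s ≤ t → t ≤ b →
      (∀ r ∈ Icc s t, (c r).proj ∈ (chartAt E x).source) → IntervalIntegrable
        (fun r => force L γ x (fun i => w i r) (velocityChart x (lift a b c r))) volume s t := by
    intro x s t has hst htb hx
    refine ContinuousOn.intervalIntegrable ?_
    rw [uIcc_of_le hst]
    exact hc.continuousOn_force hab hL hγ hw (Icc_subset_Icc has htb) hx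
  constructor
  · intro h
    refine ⟨fun t ht x hx => ?_, fun t ht x hx e => ?_, fun x s t has hst htb hx => ?_⟩
    · rw [hz hx]
      exact congrArg (tangentCoord x (c t).proj) (h.kinematic t ht)
    · rw [hz hx]
      exact (legendre_iff hL hx _ _).1 (h.legendre t ht) e
    · refine ContinuousLinearMap.ext fun e => ?_
      rw [ContinuousLinearMap.intervalIntegral_apply (hint has hst htb hx)]
      exact (hc.momentum_iff hab hL hγ hw has hst htb hx e).1
        (h.momentum x s t has hst htb hx e)
  · intro h
    refine ⟨fun t ht => ?_, fun x s t has hst htb hx e => ?_, fun t ht => ?_⟩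
    · have hx := mem_chart_source E (c t).proj
      have h1 := h.kinematic t ht _ hx
      rw [hz hx] at h1
      have h2 := congrArg (tangentCoordSymm (c t).proj (c t).proj) h1
      simpa only [tangentCoordSymm_apply hx] using h2
    · refine (hc.momentum_iff hab hL hγ hw has hst htb hx e).2 ?_
      have h1 := h.momentum x s t has hst htb hx
      rw [h1, ContinuousLinearMap.intervalIntegral_apply (hint has hst htb hx)]
    · have hx := mem_chart_source E (c t).proj
      refine (legendre_iff hL hx _ _).2 fun e => ?_
      have h1 := h.legendre t ht _ hx e
      rwa [hz hx] at h1

/-- In every chart the boundary term is the reduced momentum applied to `δq`. -/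
theorem boundaryTerm_eq (hγ : ∀ i, ContMDiff 𝓘(ℝ, E) 𝓘(ℝ, ℝ) 2 (γ i)) {x : Q} {t : ℝ}
    {δ : E × (E × (E × (E →L[ℝ] ℝ)))}
    (hsrc : ∀ᶠ ε in 𝓝 (0 : ℝ), (Γ ε t).proj ∈ (chartAt E x).source)
    (hδ : HasDerivAt (fun ε => velocityChart x (lift a b (Γ ε) t)) δ 0) :
    boundaryTerm γ w Γ t = reducedMomentum γ x (fun i => w i t)
      (velocityChart x (lift a b (Γ 0) t)) δ.1 := by
  have h0 := hsrc.self_of_nhds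
  have hz : ∀ {ε}, (Γ ε t).proj ∈ (chartAt E x).source →
      velocityChart x (lift a b (Γ ε) t) = (extChartAt 𝓘(ℝ, E) x (Γ ε t).proj,
        (tangentCoord x (Γ ε t).proj (velocity a b (Γ ε) t),
          (tangentCoord x (Γ ε t).proj (Γ ε t).2.1,
            (Γ ε t).2.2.comp (tangentCoordSymm x (Γ ε t).proj)))) := fun hx =>
    velocityChart_apply hx _ _ _
  have hd : HasDerivAt (fun ε => extChartAt 𝓘(ℝ, E) x (Γ ε t).proj) δ.1 0 :=
    (show HasDerivAt (fun ε => (velocityChart x (lift a b (Γ ε) t)).1) δ.1 0 from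
      hδ.fst).congr_of_eventuallyEq (hsrc.mono fun ε hε => (congrArg Prod.fst (hz hε)).symm)
  have hmd : MDifferentiableAt 𝓘(ℝ, ℝ) 𝓘(ℝ, E) (fun ε => (Γ ε t).proj) 0 := by
    have h1 : MDifferentiableAt 𝓘(ℝ, E) 𝓘(ℝ, E) (extChartAt 𝓘(ℝ, E) x).symm
        (extChartAt 𝓘(ℝ, E) x (Γ 0 t).proj) :=
      (mdifferentiableOn_extChartAt_symm (I := 𝓘(ℝ, E)) (x := x)).mdifferentiableAt
        ((isOpen_extChartAt_target x).mem_nhds (mem_target_of_mem_source h0))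
    refine (h1.comp (0 : ℝ) hd.differentiableAt.mdifferentiableAt).congr_of_eventuallyEq ?_
    exact hsrc.mono fun ε hε => ((extChartAt 𝓘(ℝ, E) x).left_inv (by simpa using hε)).symm
  have hT : tangentCoord x (Γ 0 t).proj
      (mfderiv 𝓘(ℝ, ℝ) 𝓘(ℝ, E) (fun ε => (Γ ε t).proj) 0 (1 : ℝ)) = δ.1 := by
    have h1 := hasDerivWithinAt_extChartAt_comp (s := univ) hmd.mdifferentiableWithinAt h0
    rw [mfderivWithin_univ, hasDerivWithinAt_univ] at h1
    exact h1.unique hd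
  have hg : ∀ i, deriv (fun ε => γ i (Γ ε t).proj) 0
      = fderiv ℝ (localPotential E (γ i) x) (extChartAt 𝓘(ℝ, E) x (Γ 0 t).proj) δ.1 := by
    intro i
    have h1 := (differentiableAt_localPotential (hγ i)
      (mem_target_of_mem_source h0)).hasFDerivAt.comp_hasDerivAt (0 : ℝ) hd
    refine (h1.congr_of_eventuallyEq ?_).deriv
    exact hsrc.mono fun ε hε => (localPotential_apply (γ i) hε).symm
  have hp : (Γ 0 t).2.2 (mfderiv 𝓘(ℝ, ℝ) 𝓘(ℝ, E) (fun ε => (Γ ε t).proj) 0 (1 : ℝ))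
      = (Γ 0 t).2.2 (tangentCoordSymm x (Γ 0 t).proj δ.1) := by
    rw [← hT, tangentCoordSymm_apply h0]
  rw [hz h0, reducedMomentum, boundaryTerm, hp]
  simp only [hg, sub_apply, sum_apply, smul_apply, smul_eq_mul, ContinuousLinearMap.comp_apply]

theorem continuousOn_boundaryTerm (hab : a < b)
    (hΓ : ∀ᶠ ε in 𝓝 (0 : ℝ), IsPath a b q₁ q₂ (Γ ε)) (hd : DifferentiableFamily a b Γ)
    (hγ : ∀ i, ContMDiff 𝓘(ℝ, E) 𝓘(ℝ, ℝ) 2 (γ i)) (hw : ∀ i, ContinuousOn (w i) (Icc a b)) :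
    ContinuousOn (boundaryTerm γ w Γ) (Icc a b) := by
  intro t ht
  obtain ⟨x, U, hU, hUI, hsrc, δ, -, hδc, hder⟩ := hd.exists_coord hab hΓ ht
  have htU : t ∈ U := mem_of_mem_nhdsWithin ht hU
  have h1 := ((hΓ.self_of_nhds.continuousOn_reducedMomentum hab hγ hw hUI
    hsrc.self_of_nhds).clm_apply hδc.fst).congr fun r hr =>
      boundaryTerm_eq hγ (hsrc.mono fun ε hε => hε r hr) (hder r hr)
  exact (h1 t htU).mono_of_mem_nhdsWithin hU

/-- Along solutions the first variation of the density is the derivative of the boundary term. -/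
theorem hasDerivAt_boundaryTerm (hab : a < b)
    (hΓ : ∀ᶠ ε in 𝓝 (0 : ℝ), IsPath a b q₁ q₂ (Γ ε)) (hd : DifferentiableFamily a b Γ)
    (hL : ContMDiff 𝓘(ℝ, E).tangent 𝓘(ℝ, ℝ) 2 L)
    (hγ : ∀ i, ContMDiff 𝓘(ℝ, E) 𝓘(ℝ, ℝ) 2 (γ i)) (hw : ∀ i, ContinuousOn (w i) (Icc a b))
    (hsol : IsLocalSolution L γ w a b (lift a b (Γ 0))) {t : ℝ} (ht : t ∈ Ioo a b) :
    HasDerivAt (boundaryTerm γ w Γ) (deriv (fun ε => density L γ w a b (Γ ε) t) 0) t := by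
  have htI := Ioo_subset_Icc_self ht
  obtain ⟨x, U, hU, hUI, hsrc, δ, hδ, hδc, hder⟩ := hd.exists_coord hab hΓ htI
  rw [nhdsWithin_eq_nhds.2 (Icc_mem_nhds ht.1 ht.2)] at hU
  have htU := mem_of_mem_nhds hU
  have h0 := hΓ.self_of_nhds
  have hsrc0 := hsrc.self_of_nhds
  set z : ℝ → ℝ → E × (E × (E × (E →L[ℝ] ℝ))) := fun ε t => velocityChart x (lift a b (Γ ε) t)
    with hzdef
  set red : ℝ → E →L[ℝ] ℝ := fun r => reducedMomentum γ x (fun i => w i r) (z 0 r) with hred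
  set frc : ℝ → E →L[ℝ] ℝ := fun r => force L γ x (fun i => w i r) (z 0 r) with hfrc
  -- the reduced momentum is the primitive of the force
  have hredd : HasDerivAt red (frc t) t := by
    obtain ⟨r, hr, hrU⟩ := Metric.nhds_basis_closedBall.mem_iff.1 hU
    rw [Real.closedBall_eq_Icc] at hrU
    have hsub : Icc (t - r) (t + r) ⊆ Icc a b := hrU.trans hUI
    have hfc : ContinuousOn frc (Icc (t - r) (t + r)) :=
      h0.continuousOn_force hab hL hγ hw hsub fun s hs => hsrc0 s (hrU hs)
    have hmem : Icc (t - r) (t + r) ∈ 𝓝 t := Icc_mem_nhds (by linarith) (by linarith)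
    have h1 : HasDerivAt (fun s => ∫ ρ in (t - r)..s, frc ρ) (frc t) t := by
      refine intervalIntegral.integral_hasDerivAt_right ?_ ?_ (hfc.continuousAt hmem)
      · refine (hfc.mono ?_).intervalIntegrable
        rw [uIcc_of_le (by linarith)]
        exact Icc_subset_Icc_right (by linarith)
      · exact hfc.stronglyMeasurableAtFilter_nhdsWithin measurableSet_Icc t |>.filter_mono
          (by rw [nhdsWithin_eq_nhds.2 hmem])
    refine (h1.const_add (red (t - r))).congr_of_eventuallyEq ?_
    filter_upwards [hmem] with s hs
    have h2 := hsol.momentum x (t - r) s (hsub (left_mem_Icc.2 (by linarith))).1 hs.1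
      (hsub hs).2 fun ρ hρ => hsrc0 ρ (hrU ⟨hρ.1, hρ.2.trans hs.2⟩)
    rw [← h2]
    simp [hred, hzdef]
  -- the time derivative of `δq` is the variation of `dq/dt`
  have hδd : HasDerivAt (fun r => (δ r).1) (δ t).2.1 t := by
    have hle : 𝓝 t ≤ 𝓟 U := le_principal_iff.2 hU
    have hu : TendstoUniformlyOn (fun ε r => ε⁻¹ • ((z ε r).2.1 - (z 0 r).2.1))
        (fun r => (δ r).2.1) (𝓝[≠] 0) U :=
      (uniformContinuous_fst.comp uniformContinuous_snd).comp_tendstoUniformlyOn hδ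
    have hy : ∀ r ∈ U, Tendsto (fun ε => ε⁻¹ • ((z ε r).1 - (z 0 r).1)) (𝓝[≠] 0)
        (𝓝 (δ r).1) := fun r hr =>
      (uniformContinuous_fst.comp_tendstoUniformlyOn hδ).tendsto_at hr
    refine hasDerivAt_of_tendstoUniformlyOnFilter (l := 𝓝[≠] (0 : ℝ))
      (f := fun ε r => ε⁻¹ • ((z ε r).1 - (z 0 r).1))
      (f' := fun ε r => ε⁻¹ • ((z ε r).2.1 - (z 0 r).2.1)) (g' := fun r => (δ r).2.1)
      ((tendstoUniformlyOn_iff_tendstoUniformlyOnFilter.1 hu).mono_right hle) ?_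
      (eventually_of_mem hU hy)
    have hcoord : ∀ {ε r}, IsPath a b q₁ q₂ (Γ ε) → (∀ t ∈ U, (Γ ε t).proj ∈ (chartAt E x).source) →
        U ∈ 𝓝 r → r ∈ Ioo a b → HasDerivAt (fun r => (z ε r).1) (z ε r).2.1 r := by
      intro ε r hp hs hUr hr
      have h1 := (hp.hasDerivWithinAt_coord (Ioo_subset_Icc_self hr)
        (hs r (mem_of_mem_nhds hUr))).hasDerivAt (Icc_mem_nhds hr.1 hr.2)
      have h2 : ∀ {s}, s ∈ U → z ε s = (extChartAt 𝓘(ℝ, E) x (Γ ε s).proj,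
        (tangentCoord x (Γ ε s).proj (velocity a b (Γ ε) s),
          (tangentCoord x (Γ ε s).proj (Γ ε s).2.1,
            (Γ ε s).2.2.comp (tangentCoordSymm x (Γ ε s).proj)))) := fun hs' =>
        velocityChart_apply (hs _ hs') _ _ _
      rw [h2 (mem_of_mem_nhds hUr)]
      refine h1.congr_of_eventuallyEq ?_
      filter_upwards [hUr] with s hs'
      rw [h2 hs']
    have hev : ∀ᶠ ε in 𝓝[≠] (0 : ℝ), IsPath a b q₁ q₂ (Γ ε) ∧
        ∀ t ∈ U, (Γ ε t).proj ∈ (chartAt E x).source :=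
      eventually_nhdsWithin_of_eventually_nhds (hΓ.and hsrc)
    have hev' : ∀ᶠ r in 𝓝 t, U ∈ 𝓝 r ∧ r ∈ Ioo a b :=
      (eventually_mem_nhds_iff.2 hU).and (Ioo_mem_nhds ht.1 ht.2)
    filter_upwards [hev.prod_mk hev'] with n hn
    exact ((hcoord hn.1.1 hn.1.2 hn.2.1 hn.2.2).fun_sub
      (hcoord h0 hsrc0 hn.2.1 hn.2.2)).fun_const_smul _
  have hB := hredd.clm_apply hδd
  have hD : deriv (fun ε => density L γ w a b (Γ ε) t) 0
      = frc t (δ t).1 + red t (δ t).2.1 := by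
    have h1 := hasDerivAt_localDensity hL hγ (k := fun i => w i t)
      (velocityChart_lift_mem (hsrc0 t htU)) (hder t htU)
    have h2 : (fun ε => density L γ w a b (Γ ε) t) =ᶠ[𝓝 0]
        fun ε => localDensity L γ x (fun i => w i t) (velocityChart x (lift a b (Γ ε) t)) := by
      filter_upwards [hΓ, hsrc] with ε hp hs
      exact hp.density_eq_localDensity hab hγ htI (hs t htU)
    rw [(h1.congr_of_eventuallyEq h2).deriv,
      ← hsol.legendre t htI x (hsrc0 t htU), hsol.kinematic t htI x (hsrc0 t htU)]
    simp [hred, hfrc, hzdef]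
  rw [hD]
  refine hB.congr_of_eventuallyEq ?_
  filter_upwards [hU] with r hr
  exact boundaryTerm_eq hγ (hsrc.mono fun ε hε => hε r hr) (hder r hr)

/-- Solutions of the stochastic Hamilton–Pontryagin equations are critical points: the first
variation of the action is a difference of boundary terms, which vanish as the end points of the
curves are fixed. -/
theorem IsPath.isCritical_of_solvesHP (hab : a < b) (hc : IsPath a b q₁ q₂ c)
    (hL : ContMDiff 𝓘(ℝ, E).tangent 𝓘(ℝ, ℝ) 2 L)
    (hγ : ∀ i, ContMDiff 𝓘(ℝ, E) 𝓘(ℝ, ℝ) 2 (γ i)) (hw : ∀ i, ContinuousOn (w i) (Icc a b))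
    (hsol : SolvesHP L γ w a b c) : IsCritical L γ w a b q₁ q₂ c := by
  intro Γ hΓ h0 hd
  have hsol' := ((hc.solvesHP_iff hab hL hγ hw).1 hsol).congr (lift_congr h0)
  obtain ⟨hint, hder⟩ := hd.hasDerivAt_action hab hΓ hL hγ hw
  refine hder.congr_deriv ?_
  rw [intervalIntegral.integral_eq_sub_of_hasDerivAt_of_le hab.le
    (continuousOn_boundaryTerm hab hΓ hd hγ hw)
    (fun t ht => hasDerivAt_boundaryTerm hab hΓ hd hL hγ hw hsol' ht) hint,
    boundaryTerm_eq_zero (hΓ.mono fun ε h => h.left),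
    boundaryTerm_eq_zero (hΓ.mono fun ε h => h.right), sub_zero]

end

/-! ### Calculus of variations on an interval -/

section

/-- Fundamental lemma of the calculus of variations for continuous functions on `[s, t]`. -/
theorem eqOn_zero_of_integral_mul_eq_zero {s t : ℝ} (hst : s < t) {f : ℝ → ℝ}
    (hf : ContinuousOn f (Icc s t))
    (h : ∀ ψ : ℝ → ℝ, ContDiff ℝ ((⊤ : ℕ∞) : WithTop ℕ∞) ψ → HasCompactSupport ψ →
      tsupport ψ ⊆ Ioo s t → ∫ r, ψ r * f r = 0) : EqOn f 0 (Icc s t) := by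
  have hae := isOpen_Ioo.ae_eq_zero_of_integral_contDiff_smul_eq_zero (μ := volume) (f := f)
    (U := Ioo s t) ((hf.mono Ioo_subset_Icc_self).locallyIntegrableOn measurableSet_Ioo)
    (fun ψ hψ hc hs => by simpa using h ψ hψ hc hs)
  refine Measure.eqOn_Icc_of_ae_eq volume hst.ne ?_ hf continuousOn_const
  rw [Measure.restrict_congr_set Ioo_ae_eq_Icc.symm]
  exact (ae_restrict_iff' measurableSet_Ioo).2 hae

/-- A function which is only controlled on `[s, t]` may be multiplied by a test function and
integrated over the line. -/
theorem integrable_mul_of_tsupport_subset {s t : ℝ} {ψ f : ℝ → ℝ} (hψ : Continuous ψ)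
    (hs : tsupport ψ ⊆ Ioo s t) (hf : ContinuousOn f (Icc s t)) :
    Integrable (fun r => ψ r * f r) := by
  have h1 : IntegrableOn (fun r => ψ r * f r) (Icc s t) :=
    (hψ.continuousOn.mul hf).integrableOn_Icc
  refine (integrableOn_iff_integrable_of_support_subset fun r hr => ?_).1 h1
  exact Ioo_subset_Icc_self (hs (subset_tsupport _ (left_ne_zero_of_mul hr)))

/-- A primitive of a test function with vanishing integral is a test function. -/
theorem exists_primitive_test {s t : ℝ} {θ : ℝ → ℝ}
    (hθ : ContDiff ℝ ((⊤ : ℕ∞) : WithTop ℕ∞) θ) (hc : HasCompactSupport θ)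
    (hs : tsupport θ ⊆ Ioo s t) (hst : s < t) (h0 : ∫ r, θ r = 0) :
    ∃ ψ : ℝ → ℝ, ContDiff ℝ ((⊤ : ℕ∞) : WithTop ℕ∞) ψ ∧ HasCompactSupport ψ ∧
      tsupport ψ ⊆ Ioo s t ∧ ∀ r, HasDerivAt ψ (θ r) r := by
  -- the primitive vanishes left of the support of `θ`, and right of it because `∫ θ = 0`
  obtain ⟨s', t', hs', ht', hsub⟩ : ∃ s' t', s < s' ∧ t' < t ∧ tsupport θ ⊆ Icc s' t' := by
    rcases (tsupport θ).eq_empty_or_nonempty with he | hne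
    · exact ⟨(s + t) / 2, (s + t) / 2, by linarith, by linarith, by simp [he]⟩
    · obtain ⟨u, hu⟩ := hc.isCompact.exists_isLeast hne
      obtain ⟨v, hv⟩ := hc.isCompact.exists_isGreatest hne
      exact ⟨u, v, (hs hu.1).1, (hs hv.1).2, fun r hr => ⟨hu.2 hr, hv.2 hr⟩⟩
  have hd : ∀ r, HasDerivAt (fun r => ∫ ρ in s..r, θ ρ) (θ r) r := fun r =>
    hθ.continuous.integral_hasStrictDerivAt s r |>.hasDerivAt
  have hvan : ∀ r ∉ Icc s' t', θ r = 0 := fun r hr =>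
    image_eq_zero_of_notMem_tsupport fun h => hr (hsub h)
  have htot : ∫ ρ in s..t, θ ρ = 0 := by
    rw [intervalIntegral.integral_eq_integral_of_support_subset, h0]
    exact fun r hr => Ioo_subset_Ioc_self (hs (subset_tsupport _ hr))
  have hsupp : tsupport (fun r => ∫ ρ in s..r, θ ρ) ⊆ Icc s' t' := by
    refine closure_minimal (fun r hr => ?_) isClosed_Icc
    by_contra hrn
    refine hr ?_
    rcases lt_or_ge r s' with h | h
    · refine (intervalIntegral.integral_congr (g := fun _ => (0 : ℝ)) fun ρ hρ => ?_).trans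
        (by simp)
      refine hvan ρ fun hρ' => ?_
      rcases mem_uIcc.1 hρ with h1 | h1 <;> linarith [hρ'.1, h1.2]
    · have hrt : t' < r := not_le.1 fun h' => hrn ⟨h, h'⟩
      have h1 : ∫ ρ in r..t, θ ρ = 0 := by
        refine (intervalIntegral.integral_congr (g := fun _ => (0 : ℝ)) fun ρ hρ => ?_).trans
          (by simp)
        refine hvan ρ fun hρ' => ?_
        rcases mem_uIcc.1 hρ with h1 | h1 <;> linarith [hρ'.2, h1.1]
      have h2 := intervalIntegral.integral_add_adjacent_intervals
        (hθ.continuous.intervalIntegrable s r) (hθ.continuous.intervalIntegrable (μ := volume) r t)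
      simp only
      linarith
  refine ⟨fun r => ∫ ρ in s..r, θ ρ,
    contDiff_infty_iff_deriv.2 ⟨fun r => (hd r).differentiableAt, ?_⟩,
    HasCompactSupport.of_support_subset_isCompact isCompact_Icc
      ((subset_tsupport _).trans hsupp),
    hsupp.trans (Icc_subset_Ioo hs' ht'), hd⟩
  rwa [show deriv (fun r => ∫ ρ in s..r, θ ρ) = θ from funext fun r => (hd r).deriv]

/-- Lemma of du Bois-Reymond: if `g' = f` on `[s, t]` in the weak sense, then `g` is a primitive
of `f`. -/
theorem sub_eq_integral_of_weak_deriv {s t : ℝ} (hst : s < t) {f g : ℝ → ℝ}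
    (hf : ContinuousOn f (Icc s t)) (hg : ContinuousOn g (Icc s t))
    (h : ∀ ψ : ℝ → ℝ, ContDiff ℝ ((⊤ : ℕ∞) : WithTop ℕ∞) ψ → HasCompactSupport ψ →
      tsupport ψ ⊆ Ioo s t → ∫ r, (ψ r * f r + deriv ψ r * g r) = 0) :
    g t - g s = ∫ r in s..t, f r := by
  set F : ℝ → ℝ := fun r => ∫ ρ in s..r, f ρ with hF
  have hfi : IntervalIntegrable f volume s t := by
    refine ContinuousOn.intervalIntegrable ?_
    rwa [uIcc_of_le hst.le]
  have hFc : ContinuousOn F (Icc s t) := by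
    have := intervalIntegral.continuousOn_primitive_interval (μ := volume) (f := f)
      (a := s) (b := t)
      (by rw [uIcc_of_le hst.le]; exact hf.integrableOn_Icc)
    rwa [uIcc_of_le hst.le] at this
  have hFd : ∀ r ∈ Ioo s t, HasDerivAt F (f r) r := fun r hr => by
    have hn : Icc s t ∈ 𝓝 r := Icc_mem_nhds hr.1 hr.2
    refine intervalIntegral.integral_hasDerivAt_right ?_ ?_ (hf.continuousAt hn)
    · refine (hf.mono ?_).intervalIntegrable
      rw [uIcc_of_le hr.1.le]
      exact Icc_subset_Icc_right hr.2.le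
    · exact (hf.stronglyMeasurableAtFilter_nhdsWithin measurableSet_Icc r).filter_mono
        (by rw [nhdsWithin_eq_nhds.2 hn])
  -- `g - F` is orthogonal to all derivatives of test functions
  have horth : ∀ ψ θ : ℝ → ℝ, ContDiff ℝ ((⊤ : ℕ∞) : WithTop ℕ∞) ψ → HasCompactSupport ψ →
      tsupport ψ ⊆ Ioo s t → (∀ r, HasDerivAt ψ (θ r) r) → tsupport θ ⊆ Ioo s t →
      Continuous θ → ∫ r, θ r * (g r - F r) = 0 := by
    intro ψ θ hψ hc hs hd hsθ hθ
    have hψ' : deriv ψ = θ := funext fun r => (hd r).deriv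
    have h1 := h ψ hψ hc hs
    rw [hψ'] at h1
    have hi1 := integrable_mul_of_tsupport_subset hψ.continuous hs hf
    have hi2 := integrable_mul_of_tsupport_subset hθ hsθ hg
    have hi3 := integrable_mul_of_tsupport_subset hθ hsθ hFc
    have hzero : ∀ r ∉ Ioo s t, ψ r = 0 := fun r hr =>
      image_eq_zero_of_notMem_tsupport fun h => hr (hs h)
    have hibp : ∫ r, (θ r * F r + ψ r * f r) = 0 := by
      rw [← intervalIntegral.integral_eq_integral_of_support_subset (a := s) (b := t)]
      · rw [intervalIntegral.integral_eq_sub_of_hasDerivAt_of_le hst.le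
          (f := fun r => ψ r * F r) (hψ.continuous.continuousOn.mul hFc)
          (fun r hr => (hd r).mul (hFd r hr))
          ((hi3.add hi1).intervalIntegrable)]
        simp [hzero s (by simp), hzero t (by simp)]
      · intro r hr
        refine Ioo_subset_Ioc_self ?_
        by_contra hrn
        refine hr ?_
        simp [hzero r hrn, image_eq_zero_of_notMem_tsupport fun h => hrn (hsθ h)]
    rw [integral_add hi3 hi1] at hibp
    rw [integral_add hi1 hi2] at h1
    simp only [mul_sub]
    rw [integral_sub hi2 hi3]
    linarith
  -- a test function `ρ` of integral `1`; `φ - (∫ φ) ρ` is then the derivative of a test function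
  let bump : ContDiffBump ((s + t) / 2) := ⟨(t - s) / 8, (t - s) / 4, by linarith, by linarith⟩
  set ρ : ℝ → ℝ := bump.normed volume with hρ
  have hρs : ContDiff ℝ ((⊤ : ℕ∞) : WithTop ℕ∞) ρ := bump.contDiff_normed
  have hρc : HasCompactSupport ρ := bump.hasCompactSupport_normed
  have hρt : tsupport ρ ⊆ Ioo s t := by
    rw [hρ, bump.tsupport_normed_eq, Real.closedBall_eq_Icc]
    exact Icc_subset_Ioo (show s < (s + t) / 2 - (t - s) / 4 by linarith)
      (show (s + t) / 2 + (t - s) / 4 < t by linarith)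
  have hρ1 : ∫ r, ρ r = 1 := bump.integral_normed
  have hgF : ContinuousOn (fun r => g r - F r) (Icc s t) := hg.sub hFc
  set C := ∫ r, ρ r * (g r - F r) with hC
  have hconst : EqOn (fun r => (g r - F r) - C) 0 (Icc s t) := by
    refine eqOn_zero_of_integral_mul_eq_zero hst (hgF.sub continuousOn_const) ?_
    intro φ hφ hφc hφt
    set θ : ℝ → ℝ := fun r => φ r - (∫ r, φ r) * ρ r with hθ
    have hθs : ContDiff ℝ ((⊤ : ℕ∞) : WithTop ℕ∞) θ := hφ.sub (contDiff_const.mul hρs)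
    have hθsub : tsupport θ ⊆ tsupport φ ∪ tsupport ρ := by
      refine closure_minimal (fun r hr => ?_) (hφc.isCompact.union hρc.isCompact).isClosed
      by_contra hrn
      rw [mem_union, not_or] at hrn
      refine hr ?_
      simp [hθ, image_eq_zero_of_notMem_tsupport hrn.1, image_eq_zero_of_notMem_tsupport hrn.2]
    have hθt : tsupport θ ⊆ Ioo s t := hθsub.trans (union_subset hφt hρt)
    have hθc : HasCompactSupport θ :=
      (hφc.isCompact.union hρc.isCompact).of_isClosed_subset (isClosed_tsupport _) hθsub
    have hφi : Integrable φ := hφ.continuous.integrable_of_hasCompactSupport hφc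
    have hρi : Integrable ρ := hρs.continuous.integrable_of_hasCompactSupport hρc
    have hθ0 : ∫ r, θ r = 0 := by
      rw [hθ, integral_sub hφi (hρi.const_mul _), integral_const_mul, hρ1, mul_one, sub_self]
    obtain ⟨ψ, hψ, hψc, hψt, hψd⟩ := exists_primitive_test hθs hθc hθt hst hθ0
    have h1 := horth ψ θ hψ hψc hψt hψd hθt hθs.continuous
    have hi1 := integrable_mul_of_tsupport_subset hφ.continuous hφt hgF
    have hi2 := integrable_mul_of_tsupport_subset hρs.continuous hρt hgF
    have h2 : ∫ r, θ r * (g r - F r)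
        = (∫ r, φ r * (g r - F r)) - (∫ r, φ r) * C := by
      rw [hC, ← integral_const_mul, ← integral_sub hi1 (hi2.const_mul _)]
      refine integral_congr_ae (Eventually.of_forall fun r => ?_)
      simp only [hθ]
      ring
    have h3 : ∫ r, φ r * (g r - F r - C) = (∫ r, φ r * (g r - F r)) - (∫ r, φ r) * C := by
      rw [← integral_mul_const, ← integral_sub hi1 (hφi.mul_const _)]
      refine integral_congr_ae (Eventually.of_forall fun r => ?_)
      simp only
      ring
    rw [h3, ← h2, h1]
  have hs0 := hconst (left_mem_Icc.2 hst.le)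
  have ht0 := hconst (right_mem_Icc.2 hst.le)
  simp only [hF, Pi.zero_apply, intervalIntegral.integral_same] at hs0 ht0
  linarith

end

/-! ### Variations inside a chart -/

section

variable {E : Type*} [NormedAddCommGroup E] [NormedSpace ℝ E]
variable {Q : Type*} [TopologicalSpace Q] [ChartedSpace E Q]
variable {m : ℕ} {a b : ℝ} {q₁ q₂ : Q} {c : ℝ → PontryaginBundle E Q}
variable {L : TangentBundle 𝓘(ℝ, E) Q → ℝ} {γ : Fin m → Q → ℝ} {w : Fin m → ℝ → ℝ}

/-- The density at `t` depends only on the curve near `t`. -/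
theorem density_eq_of_eventuallyEq {c' : ℝ → PontryaginBundle E Q} {t : ℝ}
    (h : c =ᶠ[𝓝[Icc a b] t] c') (ht : t ∈ Icc a b) :
    density L γ w a b c t = density L γ w a b c' t := by
  have key : ∀ c : ℝ → PontryaginBundle E Q, density L γ w a b c t
      = L ⟨(lift a b c t).proj, (lift a b c t).2.2.1⟩
        + (lift a b c t).2.2.2 ((lift a b c t).2.1 - (lift a b c t).2.2.1)
        - ∑ i, w i t * derivWithin (fun r => γ i (c r).proj) (Icc a b) t := fun c => rfl
  have hd : ∀ i, derivWithin (fun r => γ i (c r).proj) (Icc a b) t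
      = derivWithin (fun r => γ i (c' r).proj) (Icc a b) t := fun i =>
    Filter.EventuallyEq.derivWithin_eq (h.mono fun r hr => by simp only [hr])
      (by simp only [h.self_of_nhdsWithin ht])
  rw [key c, key c', lift_eq_of_eventuallyEq h ht]
  simp only [hd]

variable [IsManifold 𝓘(ℝ, E) ((⊤ : ℕ∞) : WithTop ℕ∞) Q]

open Classical in
/-- The variation of the curve `c` over the time interval `(s, t)` which in the chart at `x` is
given by adding `ε ψ d` to the coordinates `(q, v, p)`. It is used for `ψ` supported in `(s, t)` and
for `ε` so small that the varied coordinates belong to the chart. -/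
def chartVariation (c : ℝ → PontryaginBundle E Q) (x : Q) (s t : ℝ) (ψ : ℝ → ℝ)
    (d : E × (E × (E →L[ℝ] ℝ))) (ε r : ℝ) : PontryaginBundle E Q :=
  if r ∈ Ioo s t then (pontryaginChart x).symm (pontryaginChart x (c r) + (ε * ψ r) • d) else c r

section Variation

variable {x : Q} {s t : ℝ} {ψ : ℝ → ℝ} {d : E × (E × (E →L[ℝ] ℝ))}

theorem chartVariation_eq_self (hx : ∀ r ∈ Icc s t, (c r).proj ∈ (chartAt E x).source) {ε r : ℝ}
    (h : ε * ψ r = 0) : chartVariation c x s t ψ d ε r = c r := by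
  rw [chartVariation]
  split_ifs with hr
  · rw [h, zero_smul, add_zero, (pontryaginChart x).left_inv
      (mem_pontryaginChart_source.2 (hx r (Ioo_subset_Icc_self hr)))]
  · rfl

theorem chartVariation_eq_of_notMem (hx : ∀ r ∈ Icc s t, (c r).proj ∈ (chartAt E x).source)
    {ε r : ℝ} (hr : r ∉ tsupport ψ) : chartVariation c x s t ψ d ε r = c r :=
  chartVariation_eq_self hx (by rw [image_eq_zero_of_notMem_tsupport hr, mul_zero])

theorem chartVariation_eventuallyEq (hx : ∀ r ∈ Icc s t, (c r).proj ∈ (chartAt E x).source)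
    {ε r : ℝ} (hr : r ∉ tsupport ψ) : chartVariation c x s t ψ d ε =ᶠ[𝓝 r] c :=
  eventually_of_mem ((isClosed_tsupport ψ).isOpen_compl.mem_nhds hr) fun _ h =>
    chartVariation_eq_of_notMem hx h

theorem pontryaginChart_fst {z : PontryaginBundle E Q} (hz : z.proj ∈ (chartAt E x).source) :
    (pontryaginChart x z).1 = extChartAt 𝓘(ℝ, E) x z.proj :=
  congrArg Prod.fst (pontryaginChart_apply hz z.2.1 z.2.2)

/-- For small `ε` the varied coordinates stay in the domain of the chart, by compactness. -/
theorem IsPath.eventually_mem_target (hc : IsPath a b q₁ q₂ c) (has : a ≤ s) (htb : t ≤ b)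
    (hx : ∀ r ∈ Icc s t, (c r).proj ∈ (chartAt E x).source) (hψ : Continuous ψ)
    (hψc : HasCompactSupport ψ) :
    ∀ᶠ ε in 𝓝 (0 : ℝ), ∀ r ∈ Icc s t,
      pontryaginChart x (c r) + (ε * ψ r) • d ∈ (pontryaginChart x).target := by
  have hcont : ContinuousOn (fun r => extChartAt 𝓘(ℝ, E) x (c r).proj) (Icc s t) :=
    fun r hr => ((hc.hasDerivWithinAt_coord (Icc_subset_Icc has htb hr) (hx r hr)
      ).continuousWithinAt).mono (Icc_subset_Icc has htb)
  obtain ⟨ρ, hρ, hsub⟩ := (isCompact_Icc.image_of_continuousOn hcont).exists_cthickening_subset_open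
    (isOpen_extChartAt_target x) (image_subset_iff.2 fun r hr => mem_target_of_mem_source (hx r hr))
  obtain ⟨M, hM⟩ := hψc.exists_bound_of_continuous hψ
  have hlim : Tendsto (fun ε : ℝ => ‖ε‖ * (M * ‖d.1‖)) (𝓝 0) (𝓝 0) := by
    simpa using (tendsto_norm_zero (E := ℝ)).mul_const (M * ‖d.1‖)
  filter_upwards [hlim.eventually (gt_mem_nhds hρ)] with ε hε r hr
  rw [pontryaginChart_target]
  refine ⟨hsub ?_, mem_univ _⟩
  rw [Prod.fst_add, Prod.smul_fst, pontryaginChart_fst (hx r hr)]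
  refine Metric.mem_cthickening_of_dist_le _ (extChartAt 𝓘(ℝ, E) x (c r).proj) ρ _
    (mem_image_of_mem _ hr) ?_
  rw [dist_eq_norm, add_sub_cancel_left, norm_smul, norm_mul, mul_assoc]
  refine le_trans ?_ hε.le
  gcongr
  exact hM r

variable {ε : ℝ}

theorem chartVariation_proj_mem {r : ℝ} (hr : r ∈ Ioo s t)
    (hε : pontryaginChart x (c r) + (ε * ψ r) • d ∈ (pontryaginChart x).target) :
    (chartVariation c x s t ψ d ε r).proj ∈ (chartAt E x).source := by
  rw [chartVariation, if_pos hr]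
  exact mem_pontryaginChart_source.1 ((pontryaginChart x).map_target hε)

theorem pontryaginChart_chartVariation {r : ℝ} (hr : r ∈ Ioo s t)
    (hε : pontryaginChart x (c r) + (ε * ψ r) • d ∈ (pontryaginChart x).target) :
    pontryaginChart x (chartVariation c x s t ψ d ε r)
      = pontryaginChart x (c r) + (ε * ψ r) • d := by
  rw [chartVariation, if_pos hr, (pontryaginChart x).right_inv hε]

theorem extChartAt_chartVariation (hx : ∀ r ∈ Icc s t, (c r).proj ∈ (chartAt E x).source)
    {r : ℝ} (hr : r ∈ Ioo s t)
    (hε : pontryaginChart x (c r) + (ε * ψ r) • d ∈ (pontryaginChart x).target) :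
    extChartAt 𝓘(ℝ, E) x (chartVariation c x s t ψ d ε r).proj
      = extChartAt 𝓘(ℝ, E) x (c r).proj + (ε * ψ r) • d.1 := by
  rw [← pontryaginChart_fst (chartVariation_proj_mem hr hε), pontryaginChart_chartVariation hr hε,
    ← pontryaginChart_fst (hx r (Ioo_subset_Icc_self hr))]
  rfl

/-- The varied curves belong to the path space. Near a time in the support of `ψ` they are given by
their coordinates, near any other time they coincide with `c`. -/
theorem IsPath.chartVariation (hc : IsPath a b q₁ q₂ c) (has : a ≤ s) (htb : t ≤ b)
    (hx : ∀ r ∈ Icc s t, (c r).proj ∈ (chartAt E x).source)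
    (hψ : ContDiff ℝ ((⊤ : ℕ∞) : WithTop ℕ∞) ψ) (hψs : tsupport ψ ⊆ Ioo s t)
    (hε : ∀ r ∈ Icc s t,
      pontryaginChart x (c r) + (ε * ψ r) • d ∈ (pontryaginChart x).target) :
    IsPath a b q₁ q₂ (chartVariation c x s t ψ d ε) := by
  have hε' : ∀ r ∈ Ioo s t, pontryaginChart x (c r) + (ε * ψ r) • d ∈ (pontryaginChart x).target :=
    fun r hr => hε r (Ioo_subset_Icc_self hr)
  refine ⟨fun r hr => ?_, fun r hr => ?_, ?_, ?_⟩
  · by_cases hrψ : r ∈ tsupport ψ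
    · have hrI := hψs hrψ
      have hrs := hx r (Ioo_subset_Icc_self hrI)
      have h1 : ContinuousWithinAt (fun r => pontryaginChart x (c r)) (Icc a b) r :=
        (continuousAt_extChartAt' (I := 𝓘(ℝ, E).prod 𝓘(ℝ, E × (E →L[ℝ] ℝ)))
          (mem_pontryaginChart_source.2 hrs)).comp_continuousWithinAt (hc.continuousOn r hr)
      have h2 : ContinuousWithinAt (fun r => pontryaginChart x (c r) + (ε * ψ r) • d)
          (Icc a b) r :=
        h1.add (((continuous_const.mul hψ.continuous).smul
          continuous_const).continuousWithinAt)
      have h3 : ContinuousAt (pontryaginChart x).symm (pontryaginChart x (c r) + (ε * ψ r) • d) :=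
        continuousAt_extChartAt_symm'' (I := 𝓘(ℝ, E).prod 𝓘(ℝ, E × (E →L[ℝ] ℝ))) (hε' r hrI)
      refine (h3.comp_continuousWithinAt
        (f := fun r => pontryaginChart x (c r) + (ε * ψ r) • d)
        h2).congr_of_eventuallyEq_of_mem ?_ hr
      filter_upwards [nhdsWithin_le_nhds (isOpen_Ioo.mem_nhds hrI)] with r' hr'
      exact if_pos hr'
    · exact (hc.continuousOn r hr).congr_of_eventuallyEq_of_mem
        (nhdsWithin_le_nhds (chartVariation_eventuallyEq hx hrψ)) hr
  · by_cases hrψ : r ∈ tsupport ψ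
    · have hrI := hψs hrψ
      have h1 : ContDiffWithinAt ℝ 1
          (fun r => extChartAt 𝓘(ℝ, E) x (c r).proj + (ε * ψ r) • d.1) (Icc a b) r :=
        (hc.contDiffWithinAt_coord hr (hx r (Ioo_subset_Icc_self hrI))).add
          (((contDiff_const.mul (hψ.of_le (by exact_mod_cast le_top))).smul
            contDiff_const).contDiffWithinAt)
      have hm : extChartAt 𝓘(ℝ, E) x (c r).proj + (ε * ψ r) • d.1
          ∈ (extChartAt 𝓘(ℝ, E) x).target := by
        rw [← extChartAt_chartVariation hx hrI (hε' r hrI)]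
        exact mem_target_of_mem_source (chartVariation_proj_mem hrI (hε' r hrI))
      have h2 : ContMDiffAt 𝓘(ℝ, E) 𝓘(ℝ, E) 1 (extChartAt 𝓘(ℝ, E) x).symm
          (extChartAt 𝓘(ℝ, E) x (c r).proj + (ε * ψ r) • d.1) :=
        (contMDiffOn_extChartAt_symm x).contMDiffAt ((isOpen_extChartAt_target x).mem_nhds hm)
      refine (h2.comp_contMDiffWithinAt r h1.contMDiffWithinAt).congr_of_eventuallyEq_of_mem ?_ hr
      filter_upwards [nhdsWithin_le_nhds (isOpen_Ioo.mem_nhds hrI)] with r' hr'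
      have h3 := chartVariation_proj_mem hr' (hε' r' hr')
      exact ((extChartAt 𝓘(ℝ, E) x).left_inv (by simpa using h3)).symm.trans
        (congrArg _ (extChartAt_chartVariation hx hr' (hε' r' hr')))
    · refine (hc.contMDiffOn r hr).congr_of_eventuallyEq_of_mem ?_ hr
      filter_upwards [nhdsWithin_le_nhds (chartVariation_eventuallyEq (d := d) (ε := ε) hx hrψ)]
        with r' hr'
      rw [hr']
  · rw [chartVariation_eq_of_notMem hx fun h => not_lt_of_ge has (hψs h).1, hc.left]
  · rw [chartVariation_eq_of_notMem hx fun h => not_lt_of_ge htb (hψs h).2, hc.right]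

/-- The variation in the coordinates `(q, dq/dt, v, p)` is affine in `ε`. -/
theorem velocityChart_chartVariation (hab : a < b) (hc : IsPath a b q₁ q₂ c) (has : a ≤ s)
    (htb : t ≤ b) (hx : ∀ r ∈ Icc s t, (c r).proj ∈ (chartAt E x).source)
    (hψ : ContDiff ℝ ((⊤ : ℕ∞) : WithTop ℕ∞) ψ) (hψs : tsupport ψ ⊆ Ioo s t)
    (hε : ∀ r ∈ Icc s t,
      pontryaginChart x (c r) + (ε * ψ r) • d ∈ (pontryaginChart x).target)
    {r : ℝ} (hr : r ∈ Ioo s t) :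
    velocityChart x (lift a b (chartVariation c x s t ψ d ε) r)
      = velocityChart x (lift a b c r)
        + ε • (ψ r • d.1, (deriv ψ r • d.1, (ψ r • d.2.1, ψ r • d.2.2))) := by
  have hrI : r ∈ Icc a b := Icc_subset_Icc has htb (Ioo_subset_Icc_self hr)
  have hεr := hε r (Ioo_subset_Icc_self hr)
  have hrs := hx r (Ioo_subset_Icc_self hr)
  have hrs' := chartVariation_proj_mem hr hεr
  have hp := hc.chartVariation has htb hx hψ hψs hε
  have hv : tangentCoord x (chartVariation c x s t ψ d ε r).proj
      (velocity a b (chartVariation c x s t ψ d ε) r)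
      = tangentCoord x (c r).proj (velocity a b c r) + (ε * deriv ψ r) • d.1 := by
    have h1 := hp.hasDerivWithinAt_coord hrI hrs'
    have h2 := (hc.hasDerivWithinAt_coord hrI hrs).add
      ((((hψ.differentiable (by simp) r).hasDerivAt.const_mul ε).smul_const d.1).hasDerivWithinAt
        (s := Icc a b))
    refine (uniqueDiffOn_Icc hab r hrI).eq_deriv _ h1 (h2.congr_of_eventuallyEq_of_mem ?_ hrI)
    filter_upwards [nhdsWithin_le_nhds (isOpen_Ioo.mem_nhds hr)] with r' hr'
    exact extChartAt_chartVariation hx hr' (hε r' (Ioo_subset_Icc_self hr'))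
  rw [velocityChart_lift hrs', velocityChart_lift hrs, hv, pontryaginChart_chartVariation hr hεr]
  simp [Prod.ext_iff, smul_smul]

theorem differentiableFamily_chartVariation (hab : a < b) (hc : IsPath a b q₁ q₂ c) (has : a ≤ s)
    (htb : t ≤ b) (hx : ∀ r ∈ Icc s t, (c r).proj ∈ (chartAt E x).source)
    (hψ : ContDiff ℝ ((⊤ : ℕ∞) : WithTop ℕ∞) ψ) (hψc : HasCompactSupport ψ)
    (hψs : tsupport ψ ⊆ Ioo s t) :
    DifferentiableFamily a b (chartVariation c x s t ψ d) := by
  have hev := hc.eventually_mem_target (d := d) has htb hx hψ.continuous hψc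
  intro t₀ ht₀
  by_cases ht : t₀ ∈ tsupport ψ
  · refine ⟨x, Ioo s t, nhdsWithin_le_nhds (isOpen_Ioo.mem_nhds (hψs ht)), ?_,
      fun r => (ψ r • d.1, (deriv ψ r • d.1, (ψ r • d.2.1, ψ r • d.2.2))), ?_⟩
    · filter_upwards [hev] with ε hε r hr
      exact mem_velocityChart_source.2
        (chartVariation_proj_mem hr (hε r (Ioo_subset_Icc_self hr)))
    · refine Metric.tendstoUniformlyOn_iff.2 fun η hη => ?_
      filter_upwards [eventually_nhdsWithin_of_eventually_nhds hev, self_mem_nhdsWithin]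
        with ε hε hε0 r hr
      rw [velocityChart_chartVariation hab hc has htb hx hψ hψs hε hr,
        velocityChart_chartVariation hab hc has htb hx hψ hψs hev.self_of_nhds hr, zero_smul,
        add_zero, add_sub_cancel_left, inv_smul_smul₀ hε0, dist_self]
      exact hη
  · have h1 : ∀ᶠ r in 𝓝[Icc a b] t₀, r ∉ tsupport ψ :=
      nhdsWithin_le_nhds ((isClosed_tsupport ψ).isOpen_compl.mem_nhds ht)
    have hsrc := hc.eventually_mem_source ht₀ (mem_chart_source E (c t₀).proj)
    have hlift : ∀ ε, ∀ r ∈ {r | (r ∉ tsupport ψ ∧ (c r).proj ∈ (chartAt E (c t₀).proj).source) ∧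
        r ∈ Icc a b}, lift a b (chartVariation c x s t ψ d ε) r = lift a b c r := fun ε r hr =>
      lift_eq_of_eventuallyEq (nhdsWithin_le_nhds (chartVariation_eventuallyEq hx hr.1.1)) hr.2
    refine ⟨(c t₀).proj, _, (h1.and hsrc).and self_mem_nhdsWithin, ?_, fun _ => 0, ?_⟩
    · refine Eventually.of_forall fun ε r hr => ?_
      rw [hlift ε r hr]
      exact mem_velocityChart_source.2 hr.1.2
    · refine Metric.tendstoUniformlyOn_iff.2 fun η hη => Eventually.of_forall fun ε r hr => ?_
      rw [hlift ε r hr, hlift 0 r hr, sub_self, smul_zero, dist_self]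
      exact hη

/-- The Euler–Lagrange equations of the action in weak form, in a chart: the first variation in
every direction `d` vanishes. -/
theorem IsCritical.integral_eq_zero (hab : a < b) (hc : IsPath a b q₁ q₂ c)
    (hL : ContMDiff 𝓘(ℝ, E).tangent 𝓘(ℝ, ℝ) 2 L)
    (hγ : ∀ i, ContMDiff 𝓘(ℝ, E) 𝓘(ℝ, ℝ) 2 (γ i)) (hw : ∀ i, ContinuousOn (w i) (Icc a b))
    (hcrit : IsCritical L γ w a b q₁ q₂ c) (has : a ≤ s)
    (htb : t ≤ b) (hx : ∀ r ∈ Icc s t, (c r).proj ∈ (chartAt E x).source)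
    (hψ : ContDiff ℝ ((⊤ : ℕ∞) : WithTop ℕ∞) ψ) (hψc : HasCompactSupport ψ)
    (hψs : tsupport ψ ⊆ Ioo s t) (d : E × (E × (E →L[ℝ] ℝ))) :
    ∫ r, (ψ r * (force L γ x (fun i => w i r) (velocityChart x (lift a b c r)) d.1
        + (fderiv ℝ (localLagrangian L x) ((velocityChart x (lift a b c r)).1,
              (velocityChart x (lift a b c r)).2.2.1) (0, d.2.1)
            - (velocityChart x (lift a b c r)).2.2.2 d.2.1)
        + d.2.2 ((velocityChart x (lift a b c r)).2.1 - (velocityChart x (lift a b c r)).2.2.1))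
      + deriv ψ r * reducedMomentum γ x (fun i => w i r) (velocityChart x (lift a b c r)) d.1)
      = 0 := by
  set Γ := chartVariation c x s t ψ d with hΓdef
  have hev := hc.eventually_mem_target (d := d) has htb hx hψ.continuous hψc
  have hΓ : ∀ᶠ ε in 𝓝 (0 : ℝ), IsPath a b q₁ q₂ (Γ ε) :=
    hev.mono fun ε hε => hc.chartVariation has htb hx hψ hψs hε
  have hd : DifferentiableFamily a b Γ :=
    differentiableFamily_chartVariation hab hc has htb hx hψ hψc hψs
  have hΓ0 : Γ 0 = c := funext fun r => chartVariation_eq_self hx (zero_mul _)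
  have h1 := (hd.hasDerivAt_action hab hΓ hL hγ hw).2.unique
    (hcrit Γ hΓ (fun r _ => by rw [hΓ0]) hd)
  have hψ0 : ∀ r ∉ tsupport ψ, ψ r = 0 ∧ deriv ψ r = 0 := fun r hr =>
    ⟨image_eq_zero_of_notMem_tsupport hr,
      image_eq_zero_of_notMem_tsupport fun h => hr (tsupport_deriv_subset h)⟩
  -- the integrand is the first variation of the density, which vanishes off the support of `ψ`
  rw [← h1, ← intervalIntegral.integral_eq_integral_of_support_subset (a := a) (b := b)]
  · refine intervalIntegral.integral_congr fun r hr => ?_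
    rw [uIcc_of_le hab.le] at hr
    by_cases hrψ : r ∈ tsupport ψ
    · have hrI := hψs hrψ
      have hz : HasDerivAt (fun ε => velocityChart x (lift a b (Γ ε) r))
          (ψ r • d.1, (deriv ψ r • d.1, (ψ r • d.2.1, ψ r • d.2.2))) 0 := by
        have h2 := ((hasDerivAt_id (0 : ℝ)).smul_const
          (ψ r • d.1, (deriv ψ r • d.1, (ψ r • d.2.1, ψ r • d.2.2)))).const_add
            (velocityChart x (lift a b c r))
        rw [one_smul] at h2
        refine h2.congr_of_eventuallyEq ?_
        filter_upwards [hev] with ε hε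
        exact velocityChart_chartVariation hab hc has htb hx hψ hψs hε hrI
      have hsrc : ∀ᶠ ε in 𝓝 (0 : ℝ), (Γ ε r).proj ∈ (chartAt E x).source :=
        hev.mono fun ε hε => chartVariation_proj_mem hrI (hε r (Ioo_subset_Icc_self hrI))
      have h3 := hasDerivAt_localDensity hL hγ (k := fun i => w i r)
        (velocityChart_lift_mem hsrc.self_of_nhds) hz
      have h4 : (fun ε => density L γ w a b (Γ ε) r) =ᶠ[𝓝 0]
          fun ε => localDensity L γ x (fun i => w i r) (velocityChart x (lift a b (Γ ε) r)) := by
        filter_upwards [hΓ, hsrc] with ε hp hs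
        exact hp.density_eq_localDensity hab hγ hr hs
      rw [(h3.congr_of_eventuallyEq h4).deriv, hΓ0]
      have h5 : ((0 : E), ψ r • d.2.1) = ψ r • ((0 : E), d.2.1) := by simp
      simp only [h5, map_smul, smul_apply, smul_eq_mul]
      ring
    · have h2 : (fun ε => density L γ w a b (Γ ε) r) = fun _ => density L γ w a b c r := by
        funext ε
        exact density_eq_of_eventuallyEq
          (nhdsWithin_le_nhds (chartVariation_eventuallyEq hx hrψ)) hr
      simp only [h2, deriv_const, (hψ0 r hrψ).1, (hψ0 r hrψ).2, zero_mul, add_zero]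
  · intro r hr
    have hrψ : r ∈ tsupport ψ := by
      by_contra h
      refine hr ?_
      simp only [(hψ0 r h).1, (hψ0 r h).2, zero_mul, add_zero]
    exact ⟨has.trans_lt (hψs hrψ).1, (hψs hrψ).2.le.trans htb⟩

end Variation

/-- Every time in `[a, b]` has a nondegenerate time interval on which the curve stays in a chart. -/
theorem IsPath.exists_Icc_source (hab : a < b) (hc : IsPath a b q₁ q₂ c) {t : ℝ} {x : Q}
    (ht : t ∈ Icc a b) (hx : (c t).proj ∈ (chartAt E x).source) :
    ∃ s s', a ≤ s ∧ s < s' ∧ s' ≤ b ∧ t ∈ Icc s s' ∧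
      ∀ r ∈ Icc s s', (c r).proj ∈ (chartAt E x).source := by
  obtain ⟨ρ, hρ, hsub⟩ := Metric.mem_nhdsWithin_iff.1 (hc.eventually_mem_source ht hx)
  refine ⟨max a (t - ρ / 2), min b (t + ρ / 2), le_max_left _ _, ?_, min_le_left _ _, ?_, ?_⟩
  · rw [max_lt_iff, lt_min_iff, lt_min_iff]
    exact ⟨⟨hab, by linarith [ht.1]⟩, by linarith [ht.2], by linarith⟩
  · exact ⟨max_le ht.1 (by linarith), le_min ht.2 (by linarith)⟩
  · rintro r ⟨hr1, hr2⟩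
    rw [max_le_iff] at hr1
    rw [le_min_iff] at hr2
    refine hsub ⟨?_, hr1.1, hr2.1⟩
    rw [Metric.mem_ball, Real.dist_eq, abs_lt]
    constructor <;> linarith [hr1.2, hr2.2]

/-- Critical points solve the stochastic Hamilton–Pontryagin equations. -/
theorem IsPath.solvesHP_of_isCritical (hab : a < b) (hc : IsPath a b q₁ q₂ c)
    (hL : ContMDiff 𝓘(ℝ, E).tangent 𝓘(ℝ, ℝ) 2 L)
    (hγ : ∀ i, ContMDiff 𝓘(ℝ, E) 𝓘(ℝ, ℝ) 2 (γ i)) (hw : ∀ i, ContinuousOn (w i) (Icc a b))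
    (hcrit : IsCritical L γ w a b q₁ q₂ c) : SolvesHP L γ w a b c := by
  rw [hc.solvesHP_iff hab hL hγ hw]
  have h0 : ((0 : E), (0 : E)) = 0 := rfl
  refine ⟨fun t ht x hxt => ?_, fun t ht x hxt e => ?_, fun x s t has hst htb hx => ?_⟩
  -- varying `p` gives `dq/dt = v`
  · obtain ⟨s, s', has, hss, hsb, hts, hx⟩ := hc.exists_Icc_source hab ht hxt
    have hz := hc.continuousOn_velocityChart_lift hab (Icc_subset_Icc has hsb) hx
    rw [← sub_eq_zero]
    refine SeparatingDual.eq_zero_of_forall_dual_eq_zero (R := ℝ) fun p => ?_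
    refine eqOn_zero_of_integral_mul_eq_zero hss
      (f := fun r => p ((velocityChart x (lift a b c r)).2.1
        - (velocityChart x (lift a b c r)).2.2.1))
      (p.continuous.comp_continuousOn (hz.snd.fst.sub hz.snd.snd.fst)) (fun ψ hψ hψc hψs => ?_) hts
    simpa [h0] using hcrit.integral_eq_zero hab hc hL hγ hw has hsb hx hψ hψc hψs (0, (0, p))
  -- varying `v` gives the Legendre condition
  · obtain ⟨s, s', has, hss, hsb, hts, hx⟩ := hc.exists_Icc_source hab ht hxt
    have hz := hc.continuousOn_velocityChart_lift hab (Icc_subset_Icc has hsb) hx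
    have hm : ∀ r ∈ Icc s s', (velocityChart x (lift a b c r)).1 ∈ (extChartAt 𝓘(ℝ, E) x).target :=
      fun r hr => velocityChart_lift_mem (hx r hr)
    refine (sub_eq_zero.1 (eqOn_zero_of_integral_mul_eq_zero hss
      (f := fun r => fderiv ℝ (localLagrangian L x) ((velocityChart x (lift a b c r)).1,
          (velocityChart x (lift a b c r)).2.2.1) (0, e)
        - (velocityChart x (lift a b c r)).2.2.2 e)
      (ContinuousOn.sub ?_ (hz.snd.snd.snd.clm_apply continuousOn_const))
      (fun ψ hψ hψc hψs => ?_) hts)).symm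
    · exact (((contDiffOn_localLagrangian hL x).continuousOn_fderiv_of_isOpen
        ((isOpen_extChartAt_target x).prod isOpen_univ) (by norm_num)).comp
        (hz.fst.prodMk hz.snd.snd.fst) fun r hr => ⟨hm r hr, mem_univ _⟩).clm_apply
        continuousOn_const
    · simpa using hcrit.integral_eq_zero hab hc hL hγ hw has hsb hx hψ hψc hψs (0, (e, 0))
  -- varying `q` gives the momentum equation in weak form
  · rcases hst.eq_or_lt with rfl | hst'
    · simp
    have hsub : Icc s t ⊆ Icc a b := Icc_subset_Icc has htb
    have hf := hc.continuousOn_force hab hL hγ hw hsub hx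
    have hr := hc.continuousOn_reducedMomentum hab hγ hw hsub hx
    refine ContinuousLinearMap.ext fun e => ?_
    rw [ContinuousLinearMap.intervalIntegral_apply
      (ContinuousOn.intervalIntegrable (by rwa [uIcc_of_le hst])), sub_apply]
    refine sub_eq_integral_of_weak_deriv hst'
      (f := fun r => force L γ x (fun i => w i r) (velocityChart x (lift a b c r)) e)
      (g := fun r => reducedMomentum γ x (fun i => w i r) (velocityChart x (lift a b c r)) e)
      (hf.clm_apply continuousOn_const) (hr.clm_apply continuousOn_const)
      fun ψ hψ hψc hψs => ?_
    simpa [h0] using hcrit.integral_eq_zero hab hc hL hγ hw has htb hx hψ hψc hψs (e, (0, 0))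

end

end StochHP

end

theorem mainTheorem1
    {E : Type*} [NormedAddCommGroup E] [NormedSpace ℝ E] [FiniteDimensional ℝ E]
    {Q : Type*} [TopologicalSpace Q] [T2Space Q] [ParacompactSpace Q]
    [ChartedSpace E Q] [IsManifold 𝓘(ℝ, E) ((⊤ : ℕ∞) : WithTop ℕ∞) Q]
    {Ω : Type*} {mΩ : MeasurableSpace Ω} (P : Measure Ω) [IsProbabilityMeasure P]
    (𝓕 : Filtration ℝ mΩ) (a b : ℝ) (hab : a < b)
    (m : ℕ) (W : Fin m → ℝ → Ω → ℝ)
    (hW : ∀ i, StochHP.IsWienerOn P 𝓕 (W i) a b)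
    (hWindep : iIndepFun (fun i ω (t : Icc a b) => W i t ω) P)
    (L : TangentBundle 𝓘(ℝ, E) Q → ℝ)
    (hL : ContMDiff 𝓘(ℝ, E).tangent 𝓘(ℝ, ℝ) 2 L)
    (γ : Fin m → Q → ℝ) (hγ : ∀ i, ContMDiff 𝓘(ℝ, E) 𝓘(ℝ, ℝ) 2 (γ i))
    (q₁ q₂ : Q) :
    -- the stochastic term of the action is the Stratonovich integral along random curves
    (∀ c : Ω → ℝ → StochHP.PontryaginBundle E Q,
      (∀ ω, StochHP.IsPath a b q₁ q₂ (c ω)) →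
      (∀ t ∈ Icc a b, @Measurable Ω Q mΩ (borel Q) (fun ω => (c ω t).proj)) →
      ∀ i, StochHP.IsStratonovichIntegral P (fun t ω => γ i (c ω t).proj) (W i) a b
        (fun ω => StochHP.pathIntegral (fun t => γ i (c ω t).proj) (fun t => W i t ω) a b)) ∧
    -- the variational principle
    ∀ᵐ ω ∂P, ∀ c : ℝ → StochHP.PontryaginBundle E Q, StochHP.IsPath a b q₁ q₂ c →
      (∀ i, ∃ J, StochHP.HasPathIntegral (fun t => γ i (c t).proj) (fun t => W i t ω) a b J) ∧
      (StochHP.SolvesHP L γ (fun i t => W i t ω) a b c ↔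
        StochHP.IsCritical L γ (fun i t => W i t ω) a b q₁ q₂ c) := by
  have hcont : ∀ᵐ ω ∂P, ∀ i, ContinuousOn (fun t => W i t ω) (Icc a b) :=
    ae_all_iff.2 fun i => (hW i).continuous_paths
  refine ⟨fun c hc hmeas i => ?_, ?_⟩
  · let : MeasurableSpace Q := borel Q
    have : BorelSpace Q := ⟨rfl⟩
    refine StochHP.isStratonovichIntegral_of_ae
      (fun t ht => (hγ i).continuous.measurable.comp (hmeas t ht))
      (fun t ht => ((hW i).adapted t ht).mono (𝓕.le t) le_rfl) ?_
    filter_upwards [hcont] with ω hω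
    have h := (hc ω).hasPathIntegral_potential hab (hγ i) (hω i)
    rwa [StochHP.pathIntegral_eq hab.le h]
  · filter_upwards [hcont] with ω hω c hc
    exact ⟨fun i => ⟨_, hc.hasPathIntegral_potential hab (hγ i) (hω i)⟩,
      hc.isCritical_of_solvesHP hab hL hγ hω, hc.solvesHP_of_isCritical hab hL hγ hω⟩
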